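/- Let $n,k$ be positive integers, $[n]=\{1,\dots,n\}$. For a family $S$ of subsets of $[n]$ let the shadow $\Delta(S)$ be the family of all sets $s\setminus\{x\}$ with $s\in S$, $x\in s$, and let $\Delta^{4}(S)$ be its fourth iterate. Every integer $m\ge 1$ has a unique $k$-binomial decomposition $$m=\binom{a_0}{k}+\binom{a_1}{k-1}+\cdots+\binom{a_t}{k-t},\qquad a_0>a_1>\cdots>a_t\ge k-t\ge 1 .$$ Write $\binom{\mathbf a}{r}=\sum_{j=0}^{t}\binom{a_j}{r-j}$ for $r\in\mathbb Z$, where binomial coefficients with negative lower entry are $0$. A non-empty family $S\subseteq\binom{[n]}{k}$ of size $m$ is called extremal if $|\Delta(S)|=\binom{\mathbf a}{k-1}$, that is, if it attains the Kruskal--Katona lower bound. The colex order on $r$-subsets of $[n]$ is given by $x<y$ iff $x\ne y$ and $\max\big((x\setminus y)\cup(y\setminus x)\big)\in y$, and $I_{n,r}(M)$ denotes the family of the first $M$ $r$-subsets of $[n]$ in this order ($I_{n,r}(0)=\emptyset$). **Theorem.** Fix a positive integer $k$. For $n>k$ let $N=\binom nk$ and let $U=U_{n,k}\subseteq\{1,\dots,N\}$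 be the set of those $m$, with $k$-binomial decomposition $\mathbf a$, such that for every extremal family $S\subseteq\binom{[n]}{k}$ with $|S|=m$ some permutation of $[n]$ maps $\Delta^{4}(S)$ onto $I_{n,k-4}\big(\binom{\mathbf a}{k-4}\big)$ (for $k<4$ both families are empty). Then $$\lim_{n\to\infty}\frac{|U_{n,k}|}{\binom nk}=1 .$$ -/

import Mathlib

open Finset

namespace ColexShadow

/-- `a = (a 0, …, a t)` is the `k`-binomial decomposition of `m`:
`m = C(a 0, k) + C(a 1, k - 1) + ⋯ + C(a t, k - t)` with `a 0 > a 1 > ⋯ > a t ≥ k - t ≥ 1`. -/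
structure IsBinomDecomp (k m t : ℕ) (a : Fin (t + 1) → ℕ) : Prop where
  strictAnti : StrictAnti a
  lt : t < k
  le_last : k - t ≤ a (Fin.last t)
  sum_eq : ∑ j : Fin (t + 1), (a j).choose (k - j) = m

/-- The number `C(a 0, r) + C(a 1, r - 1) + ⋯ + C(a t, r - t)` for an integer `r`, where a binomial
coefficient with a negative lower entry is `0`. -/
def binomSum (r : ℤ) {t : ℕ} (a : Fin (t + 1) → ℕ) : ℕ :=
  ∑ j : Fin (t + 1), if (j : ℤ) ≤ r then (a j).choose (r - j).toNat else 0

/-- A family `S` of `k`-subsets of `[n]` is extremal: its shadow attains the Kruskal-Katona lower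
bound given by the `k`-binomial decomposition of `#S`. -/
def IsExtremal {n : ℕ} (k : ℕ) (S : Finset (Finset (Fin n))) : Prop :=
  (S : Set (Finset (Fin n))).Sized k ∧
    ∃ (t : ℕ) (a : Fin (t + 1) → ℕ), IsBinomDecomp k #S t a ∧ #(shadow S) = binomSum (k - 1) a

/-- Up to a permutation of `[n]`, the family `F` is the initial segment of length `m` in the colex
order on the `r`-subsets of `[n]`. -/
def IsoColexInitSeg {n : ℕ} (r m : ℕ) (F : Finset (Finset (Fin n))) : Prop :=
  ∃ (I : Finset (Finset (Fin n))) (σ : Equiv.Perm (Fin n)),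
    Colex.IsInitSeg I r ∧ #I = m ∧ F.image (Finset.image σ) = I

/-- The set `U` of all `m` with `1 ≤ m ≤ C(n, k)` such that every extremal family of `k`-subsets of
`[n]` with cardinality `m` has as fourth iterated shadow, up to a permutation of `[n]`, the colex
initial segment of length `binomSum (k - 4) a`, where `a` is the `k`-binomial decomposition of `m`.
(If `k < 4`, the fourth iterated shadow is the empty family, the length is `0`, and the uniformity
`k - 4` plays no role.) -/
def goodCards (n k : ℕ) : Set ℕ :=
  {m | m ∈ Set.Icc 1 (n.choose k) ∧
    ∀ S : Finset (Finset (Fin n)), IsExtremal k S → #S = m →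
      ∃ (t : ℕ) (a : Fin (t + 1) → ℕ), IsBinomDecomp k m t a ∧
        IsoColexInitSeg (k - 4) (binomSum (k - 4) a) (shadow^[4] S)}

end ColexShadow

/-!
Call an extremal family `S` of `k`-subsets of `[n]` *spread* if its size has a `k`-binomial
decomposition of full length `k` whose entries `a 0, …, a (k - 1)` are at least `n / D`, and
consecutive entries are at least `n / D` apart; the last two are only required to be weakly
decreasing. For fixed `k`, all but a proportion `O(1 / D)` of the numbers up to `C(n, k)` have such
a decomposition (`card_not_gapped_le`). It therefore suffices to determine the fourth shadow of spread
extremal families for `n` large in terms of `k` and `D`; this is `exists_isCascade`, and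
`IsCascade.exists_perm` turns its conclusion into an isomorphism with a colex initial segment.

The proof is an induction on `k` which removes a point `x`. The link `S.memberSubfamily x` of size
`d` and the deletion `S.nonMemberSubfamily x` have disjoint contributions to the shadow, so that, for
the Kruskal-Katona function `kk`, extremality gives
`kk k (m - d) + kk (k - 1) d ≤ kk k m` with `m = C(a 0, k) + m'`.

* Strict subadditivity of `kk` excludes `0 < d < m'`, and a strict form of its concavity at spread
  cascades (`kk_strict`) excludes that `d` is at distance more than `O(n)` from both `m'` and
  `C(a 0 - 1, k - 1)` (`degree_dichotomy`).
* Not all positive degrees are close to `C(a 0 - 1, k - 1)` (`exists_degree_lt`). Otherwise there are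
  only `a 0 + O(1)` points, and almost nothing is missing in the shadow of any link. A double count
  of the pairs consisting of a set missing in the shadow and a set missing in the family then
  contradicts the value of `kk k m` (`card_mul_le_of_few_cliques`, `upper_shadow_count`).
* A point `x` of degree `m' + e` with `e = O(n)` has a deletion which lives on a set `B` of exactly
  `a 0` points, where it lacks only `e` sets, and its link lives on `B` too
  (`exists_top_of_degree_le`).
* The second shadow of the deletion is then complete on `B` (`shadow_shadow_eq_of_few_missing`).
  If `q` sets of `B` are missing in its first shadow, then `q = O(1)` and the shadow of the link
  exceeds `kk (k - 1) m'` by at most `q`. The link is again spread and extremal: its decomposition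
  is `a 1, …, a (k - 1)` with only the last two entries changed (`exists_spread_add`). By induction
  it has the asserted fourth shadow, which does not depend on these two entries.

The shadow of `S` itself need not be the initial segment, because the deletion may lack some sets;
the second shadow of the deletion repairs this at each level of the induction, and a family of
`4`-sets, where the induction starts, has the fourth shadow `{∅}`.
-/

namespace ColexShadow

/-! ### The Kruskal-Katona function -/

/-- The Kruskal-Katona function: `kk j m` is the least size of the shadow of a family of `m` sets of
size `j`. It is defined greedily, `kk (j + 1) (C(a, j + 1) + m') = C(a, j) + kk j m'` with `a` as
large as possible. -/
def kk : ℕ → ℕ → ℕ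
  | 0, _ => 0
  | j + 1, m =>
    if m = 0 then 0 else
      (Nat.findGreatest (fun a => a.choose (j + 1) ≤ m) (m + j)).choose j +
        kk j (m - (Nat.findGreatest (fun a => a.choose (j + 1) ≤ m) (m + j)).choose (j + 1))

@[simp] lemma kk_uniformity_zero (m : ℕ) : kk 0 m = 0 := by simp [kk]

@[simp] lemma kk_zero (j : ℕ) : kk j 0 = 0 := by cases j <;> simp [kk]

lemma sub_le_choose_succ (j a : ℕ) : a - j ≤ a.choose (j + 1) := by
  induction a with
  | zero => simp
  | succ a ih =>
    rw [Nat.choose_succ_succ']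
    rcases le_or_gt j a with h | h
    · have := Nat.choose_pos h
      omega
    · omega

lemma le_choose_of_lt {r x : ℕ} (hr : 1 ≤ r) (hx : r < x) : x ≤ x.choose r := by
  induction x, hx using Nat.le_induction with
  | base => simp
  | succ x hx ih =>
    obtain ⟨r, rfl⟩ : ∃ s, r = s + 1 := ⟨r - 1, by omega⟩
    rw [Nat.choose_succ_succ']
    have := Nat.choose_pos (show r ≤ x by omega)
    omega

lemma kk_eq_of_lt {j a m' : ℕ} (ha : j + 1 ≤ a) (hm : m' < a.choose j) :
    kk (j + 1) (a.choose (j + 1) + m') = a.choose j + kk j m' := by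
  have hpos := Nat.choose_pos ha
  have hg : Nat.findGreatest (fun b => b.choose (j + 1) ≤ a.choose (j + 1) + m')
      (a.choose (j + 1) + m' + j) = a := by
    rw [Nat.findGreatest_eq_iff]
    refine ⟨?_, fun _ => by simp, fun b hb _ => ?_⟩
    · have := sub_le_choose_succ j a
      omega
    · have : (a + 1).choose (j + 1) ≤ b.choose (j + 1) := Nat.choose_le_choose _ hb
      rw [Nat.choose_succ_succ'] at this
      omega
  rw [kk, hg, if_neg (by omega), Nat.add_sub_cancel_left]

lemma kk_choose {j a : ℕ} (ha : j + 1 ≤ a) : kk (j + 1) (a.choose (j + 1)) = a.choose j := by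
  have := kk_eq_of_lt ha (Nat.choose_pos (show j ≤ a by omega))
  simpa using this

/-- The recursion for `kk`, which also holds if the remainder is as large as `C(a, j)`. -/
lemma kk_eq {j a m' : ℕ} (h0 : 0 < a.choose (j + 1) + m') (hm : m' ≤ a.choose j) :
    kk (j + 1) (a.choose (j + 1) + m') = a.choose j + kk j m' := by
  rcases hm.lt_or_eq with hlt | heq
  · rcases le_or_gt (j + 1) a with ha | ha
    · exact kk_eq_of_lt ha hlt
    · exfalso
      rw [Nat.choose_eq_zero_of_lt ha] at h0
      have : a = j ∨ a < j := by omega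
      rcases this with rfl | h
      · simp at hlt
        omega
      · rw [Nat.choose_eq_zero_of_lt h] at hlt
        omega
  · have ha : j ≤ a := by
      by_contra h
      rw [heq, Nat.choose_eq_zero_of_lt (by omega), Nat.choose_eq_zero_of_lt (by omega)] at h0
      omega
    have : a.choose (j + 1) + m' = (a + 1).choose (j + 1) := by
      rw [Nat.choose_succ_succ', heq, add_comm]
    rw [this, kk_choose (by omega), heq]
    rcases j with _ | j
    · simp
    · rw [kk_choose ha, Nat.choose_succ_succ', add_comm]

/-- Every positive `m` has a largest binomial coefficient `C(a, j + 1)` below it. -/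
lemma exists_choose_add {j m : ℕ} (hm : 0 < m) :
    ∃ a m', j + 1 ≤ a ∧ m' < a.choose j ∧ m = a.choose (j + 1) + m' := by
  set P : ℕ → Prop := fun a => a.choose (j + 1) ≤ m
  set a := Nat.findGreatest P (m + j) with ha
  have h1 : j + 1 ≤ a := Nat.le_findGreatest (P := P) (by omega) (by simp [P]; omega)
  have h2 : a.choose (j + 1) ≤ m :=
    Nat.findGreatest_spec (P := P) (m := j + 1) (by omega) (by simp [P]; omega)
  have h3 : m < (a + 1).choose (j + 1) := by
    by_contra h
    push Not at h
    have h4 : a + 1 ≤ m + j := by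
      have := sub_le_choose_succ j (a + 1)
      omega
    have := Nat.le_findGreatest (P := P) h4 h
    omega
  rw [Nat.choose_succ_succ'] at h3
  exact ⟨a, m - a.choose (j + 1), h1, by omega, by omega⟩

lemma kk_le_succ (j m : ℕ) : kk j m ≤ kk j (m + 1) := by
  induction j generalizing m with
  | zero => simp
  | succ j ih =>
    rcases Nat.eq_zero_or_pos m with rfl | hm
    · simp
    obtain ⟨a, m', ha, hm', rfl⟩ := exists_choose_add (j := j) hm
    rw [kk_eq_of_lt ha hm', add_assoc, kk_eq (by omega) hm']
    exact Nat.add_le_add_left (ih m') _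

lemma kk_mono (j : ℕ) : Monotone (kk j) := monotone_nat_of_le_succ (kk_le_succ j)

/-- The average number of sets per shadow set is at most the one in a complete family. -/
lemma kk_ratio {j y m : ℕ} (hm : m ≤ y.choose j) : j * m ≤ kk j m * (y + 1 - j) := by
  induction j generalizing m y with
  | zero => simp
  | succ j ih =>
    rcases Nat.eq_zero_or_pos m with rfl | hm0
    · simp
    obtain ⟨a, m', ha, hm', rfl⟩ := exists_choose_add (j := j) hm0
    rw [kk_eq_of_lt ha hm']
    have hid : (j + 1) * a.choose (j + 1) = a.choose j * (a - j) := by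
      rw [mul_comm, Nat.choose_succ_right_eq]
    have hay : a < y ∨ (a = y ∧ m' = 0) := by
      rcases lt_trichotomy a y with h | h | h
      · exact Or.inl h
      · subst h
        exact Or.inr ⟨rfl, by omega⟩
      · exfalso
        have h5 : (y + 1).choose (j + 1) ≤ a.choose (j + 1) := Nat.choose_le_choose _ h
        rw [Nat.choose_succ_succ'] at h5
        have : y.choose j = 0 := by omega
        rw [Nat.choose_eq_zero_iff] at this
        rw [Nat.choose_eq_zero_of_lt (by omega : y < j + 1)] at hm
        omega
    rcases hay with h | ⟨rfl, rfl⟩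
    · have h6 := ih (m := m') (y := a) hm'.le
      have h7 : kk j m' * (a + 1 - j) ≤ kk j m' * (y + 1 - (j + 1)) :=
        Nat.mul_le_mul_left _ (by omega)
      obtain ⟨z, hz⟩ : ∃ z, y + 1 - (j + 1) = (a - j) + 1 + z := ⟨y - a - 1, by omega⟩
      rw [hz] at h7 ⊢
      nlinarith [Nat.zero_le (a.choose j * z)]
    · simp only [kk_zero, add_zero]
      rw [hid]
      exact Nat.mul_le_mul_left _ (by omega)

/-! ### Subadditivity and concavity of the Kruskal-Katona function -/

lemma kk_choose_add_ge_of_subadd {j : ℕ} (hsub : ∀ u w, kk j (u + w) ≤ kk j u + kk j w)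
    {c h : ℕ} (hc : j + 1 ≤ c) : c.choose j + kk j h ≤ kk (j + 1) (c.choose (j + 1) + h) := by
  induction h using Nat.strong_induction_on generalizing c with
  | _ h ih =>
    have hpos := Nat.choose_pos hc
    have hpos' := Nat.choose_pos (show j ≤ c by omega)
    rcases le_or_gt h (c.choose j) with hle | hlt
    · rw [kk_eq (by omega) hle]
    · obtain ⟨h', rfl⟩ : ∃ h', h = c.choose j + h' := ⟨h - c.choose j, by omega⟩
      have h1 := ih h' (by omega) (c := c + 1) (by omega)
      have h2 := hsub (c.choose j) h'
      have h3 : (c + 1).choose (j + 1) + h' = c.choose (j + 1) + (c.choose j + h') := by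
        rw [Nat.choose_succ_succ']; ring
      have h4 : c.choose j + kk j (c.choose j) = (c + 1).choose j := by
        rcases j with _ | j
        · simp
        · rw [kk_choose (by omega), Nat.choose_succ_succ', add_comm]
      rw [h3] at h1
      omega

/-- The step that reduces inequalities for `kk (j + 1)` to inequalities for `kk j`: if the
`(j + 1)`-sets are split as `C(A, j + 1) + x'` and `C(b, j + 1) + m₁ + g` with `x' + g = C(A, j)`,
then `kk` of the parts is bounded below by the values of `kk j` at two numbers `p`, `q` with sum
`C(A, j) + m₁`. -/
lemma kk_core_step {j : ℕ} (hsub : ∀ u w, kk j (u + w) ≤ kk j u + kk j w) {A b m₁ x' g : ℕ}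
    (hb : j + 1 ≤ b) (hbA : b ≤ A) (hm : m₁ ≤ b.choose j) (hx : x' + g = A.choose j) :
    ∃ p q, p + q = A.choose j + m₁ ∧ p ≤ A.choose j ∧ q ≤ A.choose j ∧
      A.choose j + m₁ ≤ p + b.choose j ∧ min (m₁ + g) (b.choose j) ≤ q ∧
      b.choose j + (kk j p + kk j q) ≤ kk j x' + kk (j + 1) (b.choose (j + 1) + m₁ + g) := by
  have hbA' : b.choose j ≤ A.choose j := Nat.choose_le_choose _ hbA
  have hpos := Nat.choose_pos hb
  rcases le_or_gt (m₁ + g) (b.choose j) with h | h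
  · refine ⟨x', m₁ + g, by omega, by omega, by omega, by omega, by omega, ?_⟩
    rw [add_assoc, kk_eq (by omega) h]
    omega
  · obtain ⟨h', hh⟩ : ∃ h', m₁ + g = b.choose j + h' := ⟨m₁ + g - b.choose j, by omega⟩
    refine ⟨x' + h', b.choose j, by omega, by omega, by omega, by omega, by omega, ?_⟩
    have h1 := kk_choose_add_ge_of_subadd hsub (c := b + 1) (h := h') (by omega)
    have h2 : (b + 1).choose (j + 1) + h' = b.choose (j + 1) + m₁ + g := by
      rw [Nat.choose_succ_succ']
      omega
    have h3 := hsub x' h'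
    have h4 : b.choose j + kk j (b.choose j) = (b + 1).choose j := by
      rcases j with _ | j
      · simp
      · rw [kk_choose (by omega), Nat.choose_succ_succ', add_comm]
    rw [h2] at h1
    omega

/-- A fixed number of sets has a strictly larger minimal shadow in the next uniformity. -/
lemma kk_lt_kk_succ_of_subadd {j : ℕ}
    (hsub : ∀ u w, kk j (u + w) ≤ kk j u + kk j w) {w : ℕ} (hw : 0 < w) :
    kk j w < kk (j + 1) w := by
  have key : ∀ c, j + 1 ≤ c → kk j (c.choose (j + 1)) < c.choose j := by
    intro c hc
    induction c, hc using Nat.le_induction with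
    | base =>
      rw [Nat.choose_self]
      rcases j with _ | j
      · simp
      · have := kk_choose (le_refl (j + 1))
        rw [Nat.choose_self] at this
        rw [this]
        simp
    | succ c hc ih =>
      rw [Nat.choose_succ_succ']
      have h1 := hsub (c.choose j) (c.choose (j + 1))
      rcases j with _ | j
      · simp
      · rw [kk_choose (by omega)] at h1
        rw [Nat.choose_succ_succ' c j]
        omega
  obtain ⟨a, m', ha, hm', rfl⟩ := exists_choose_add (j := j) hw
  rw [kk_eq_of_lt ha hm']
  have h1 := hsub (a.choose (j + 1)) m'
  have h2 := key a ha
  omega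

/-- The inductive step for `kk_concave`. -/
lemma kk_concave_succ_of_concave {j : ℕ} (hsub : ∀ u w, kk j (u + w) ≤ kk j u + kk j w)
    (hcon : ∀ a x y m : ℕ, x ≤ a.choose j → y ≤ a.choose j → x + y = a.choose j + m →
      kk j (a.choose j) + kk j m ≤ kk j x + kk j y) (a x y m : ℕ)
    (hx : x ≤ a.choose (j + 1)) (hy : y ≤ a.choose (j + 1)) (hxy : x + y = a.choose (j + 1) + m) :
    kk (j + 1) (a.choose (j + 1)) + kk (j + 1) m ≤ kk (j + 1) x + kk (j + 1) y := by
  induction a generalizing x y m with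
  | zero =>
    simp at *
    have : m = 0 := by omega
    subst this
    simp
  | succ A ih =>
    rcases lt_or_ge A (j + 1) with hA | hA
    · -- then there is at most one set
      have h1 : (A + 1).choose (j + 1) ≤ 1 := by
        calc (A + 1).choose (j + 1) ≤ (j + 1).choose (j + 1) := Nat.choose_le_choose _ (by omega)
          _ = 1 := Nat.choose_self _
      rcases (show x = (A + 1).choose (j + 1) ∨ y = (A + 1).choose (j + 1) by omega) with h | h
      · have : y = m := by omega
        rw [h, this]
      · have : x = m := by omega
        rw [h, this, add_comm]
    have hch : (A + 1).choose (j + 1) = A.choose (j + 1) + A.choose j := by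
      rw [Nat.choose_succ_succ', add_comm]
    have hpos := Nat.choose_pos hA
    have hpos' := Nat.choose_pos (show j ≤ A by omega)
    -- the case in which one part contains the complete family on `A` points
    have side : ∀ x y, A.choose (j + 1) ≤ x → x ≤ (A + 1).choose (j + 1) →
        y ≤ (A + 1).choose (j + 1) → x + y = (A + 1).choose (j + 1) + m →
        kk (j + 1) ((A + 1).choose (j + 1)) + kk (j + 1) m ≤ kk (j + 1) x + kk (j + 1) y := by
      intro x y hAx hx hy hxy
      obtain ⟨x', rfl⟩ : ∃ x', x = A.choose (j + 1) + x' := ⟨x - A.choose (j + 1), by omega⟩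
      have hx' : x' ≤ A.choose j := by omega
      rw [kk_eq (by omega) hx', hch, kk_eq (by omega) le_rfl]
      obtain ⟨g, hg⟩ : ∃ g, x' + g = A.choose j := ⟨A.choose j - x', by omega⟩
      have hyg : y = m + g := by omega
      subst hyg
      rcases Nat.eq_zero_or_pos m with rfl | hm
      · have h1 := hsub x' g
        rw [hg] at h1
        rcases Nat.eq_zero_or_pos g with rfl | hg0
        · simp at hg
          simp [hg]
        · have := kk_lt_kk_succ_of_subadd hsub hg0
          simp only [kk_zero, zero_add]
          omega
      · obtain ⟨b, m₁, hb, hm₁, rfl⟩ := exists_choose_add (j := j) hm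
        rcases lt_or_ge A b with hAb | hbA
        · have h5 : (A + 1).choose (j + 1) ≤ b.choose (j + 1) := Nat.choose_le_choose _ hAb
          have : m₁ = 0 ∧ g = 0 := by omega
          obtain ⟨rfl, rfl⟩ := this
          simp at hg
          simp [hg]
        · obtain ⟨p, q, hpq, hp, hq, -, -, hle⟩ := kk_core_step hsub hb hbA hm₁.le hg
          have := hcon A p q m₁ hp hq hpq
          rw [kk_eq_of_lt hb hm₁]
          omega
    rcases le_or_gt (A.choose (j + 1)) x with h | h
    · exact side x y h hx hy hxy
    rcases le_or_gt (A.choose (j + 1)) y with h' | h'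
    · rw [add_comm (kk (j + 1) x)]
      exact side y x h' hy hx (by omega)
    have h1 := ih x y (A.choose j + m) h.le h'.le (by omega)
    have h2 := side (A.choose (j + 1)) (A.choose j + m) le_rfl (by omega) (by omega) (by omega)
    omega

/-- The inductive step for `kk_subadd`, which yields strict subadditivity. -/
lemma kk_subadd_succ_of_concave {j : ℕ} (hsub : ∀ u w, kk j (u + w) ≤ kk j u + kk j w)
    (hcon : ∀ a x y m : ℕ, x ≤ a.choose (j + 1) → y ≤ a.choose (j + 1) →
      x + y = a.choose (j + 1) + m →
      kk (j + 1) (a.choose (j + 1)) + kk (j + 1) m ≤ kk (j + 1) x + kk (j + 1) y)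
    {u w : ℕ} (hu : 0 < u) (hw : 0 < w) :
    kk (j + 1) (u + w) + 1 ≤ kk (j + 1) u + kk (j + 1) w := by
  -- the smaller part `w` is used up to complete `u` to a binomial coefficient
  have main : ∀ w u, 0 < w → w ≤ u → kk (j + 1) (u + w) + 1 ≤ kk (j + 1) u + kk (j + 1) w := by
    intro w
    induction w using Nat.strong_induction_on with
    | _ w ih =>
      intro u hw hwu
      obtain ⟨a, u', ha, hu', rfl⟩ := exists_choose_add (j := j) (show 0 < u by omega)
      have hM := kk_lt_kk_succ_of_subadd hsub hw
      rcases le_or_gt (u' + w) (a.choose j) with h | h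
      · rw [kk_eq_of_lt ha hu', add_assoc, kk_eq (by omega) h]
        have := hsub u' w
        omega
      · obtain ⟨w₂, hw₂⟩ : ∃ w₂, u' + w = a.choose j + w₂ := ⟨u' + w - a.choose j, by omega⟩
        have hch : (a + 1).choose (j + 1) = a.choose (j + 1) + a.choose j := by
          rw [Nat.choose_succ_succ', add_comm]
        have h1 := hcon (a + 1) (a.choose (j + 1) + u') w w₂ (by omega) (by omega) (by omega)
        have h2 := ih w₂ (by omega) ((a + 1).choose (j + 1)) (by omega) (by omega)
        rw [show (a + 1).choose (j + 1) + w₂ = a.choose (j + 1) + u' + w by omega] at h2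
        omega
  rcases le_total w u with h | h
  · exact main w u hw h
  · rw [add_comm u, add_comm (kk (j + 1) u)]
    exact main u w hu h

lemma kk_subadd_and_concave (j : ℕ) : (∀ u w, kk j (u + w) ≤ kk j u + kk j w) ∧
    (∀ a x y m : ℕ, x ≤ a.choose j → y ≤ a.choose j → x + y = a.choose j + m →
      kk j (a.choose j) + kk j m ≤ kk j x + kk j y) := by
  induction j with
  | zero => simp
  | succ j ih =>
    have hcon := kk_concave_succ_of_concave ih.1 ih.2
    refine ⟨fun u w => ?_, hcon⟩
    rcases Nat.eq_zero_or_pos u with rfl | hu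
    · simp
    rcases Nat.eq_zero_or_pos w with rfl | hw
    · simp
    have := kk_subadd_succ_of_concave ih.1 hcon hu hw
    omega

lemma kk_subadd (j u w : ℕ) : kk j (u + w) ≤ kk j u + kk j w := (kk_subadd_and_concave j).1 u w

lemma kk_subadd_strict (j : ℕ) {u w : ℕ} (hu : 0 < u) (hw : 0 < w) :
    kk (j + 1) (u + w) < kk (j + 1) u + kk (j + 1) w :=
  kk_subadd_succ_of_concave (kk_subadd j) (kk_subadd_and_concave (j + 1)).2 hu hw

/-- A weak form of concavity: moving two numbers apart, with the larger one ending at a binomial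
coefficient, does not increase the sum of the values of `kk j`. -/
lemma kk_concave {j a x y m : ℕ} (hx : x ≤ a.choose j) (hy : y ≤ a.choose j)
    (hxy : x + y = a.choose j + m) : kk j (a.choose j) + kk j m ≤ kk j x + kk j y :=
  (kk_subadd_and_concave j).2 a x y m hx hy hxy

/-! ### Cascades and their genericity -/

/-- The cascade sum `C(a 0, k) + C(a 1, k - 1) + ⋯ + C(a (k - 1), 1)`. -/
def cascadeSum : ℕ → (ℕ → ℕ) → ℕ
  | 0, _ => 0
  | k + 1, a => (a 0).choose (k + 1) + cascadeSum k fun i => a (i + 1)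

/-- Genericity of the cascade `a 0, …, a (k - 1)` on the scale `n`: consecutive entries differ by
more than `n / D`, and the last entry is at least `n / D`. The last two entries are only required
to be weakly decreasing; this class of cascades is stable under passing to links. -/
def IsSpread (D n : ℕ) : ℕ → (ℕ → ℕ) → Prop
  | 0, _ => True
  | 1, a => n ≤ D * a 0
  | 2, a => a 1 ≤ a 0 ∧ n ≤ D * a 1
  | k + 3, a => D * a 1 + D + n ≤ D * a 0 ∧ IsSpread D n (k + 2) fun i => a (i + 1)

lemma IsSpread.tail {D n k : ℕ} {a : ℕ → ℕ} (h : IsSpread D n (k + 1) a) :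
    IsSpread D n k fun i => a (i + 1) := by
  match k, h with
  | 0, _ => trivial
  | 1, h => exact h.2
  | k + 2, h => exact h.2

lemma IsSpread.le_top {D n k : ℕ} {a : ℕ → ℕ} (h : IsSpread D n (k + 1) a) : n ≤ D * a 0 := by
  induction k generalizing a with
  | zero => exact h
  | succ k ih =>
    have h1 := ih h.tail
    simp only [zero_add] at h1
    match k, h with
    | 0, h => exact h1.trans (Nat.mul_le_mul_left _ h.1)
    | k + 1, h => have := h.1; omega

lemma IsSpread.succ_le {D n k : ℕ} {a : ℕ → ℕ} (hD : 0 < D) (h : IsSpread D n (k + 3) a) :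
    a 1 + 1 ≤ a 0 := by
  have := h.1
  by_contra hcon
  have : D * a 0 ≤ D * a 1 := Nat.mul_le_mul_left _ (by omega)
  omega

lemma IsSpread.tail_sum_le {D n k : ℕ} {a : ℕ → ℕ} (hD : 0 < D) (h : IsSpread D n (k + 1) a) :
    cascadeSum k (fun i => a (i + 1)) ≤ (a 0).choose k := by
  induction k generalizing a with
  | zero => simp [cascadeSum]
  | succ k ih =>
    have h1 := ih h.tail
    match k, h with
    | 0, h => simpa [cascadeSum] using h.1
    | k + 1, h =>
      rw [cascadeSum]
      simp only [zero_add] at h1 ⊢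
      have hlt := h.succ_le hD
      calc (a 1).choose (k + 1 + 1) + cascadeSum (k + 1) (fun i => a (i + 1 + 1))
          ≤ (a 1).choose (k + 1 + 1) + (a 1).choose (k + 1) := by gcongr
        _ = (a 1 + 1).choose (k + 1 + 1) := by rw [Nat.choose_succ_succ' (a 1), add_comm]
        _ ≤ (a 0).choose (k + 1 + 1) := Nat.choose_le_choose _ hlt

lemma IsSpread.sum_le {D n k : ℕ} {a : ℕ → ℕ} (hD : 0 < D) (h : IsSpread D n (k + 1) a) :
    cascadeSum (k + 1) a ≤ (a 0 + 1).choose (k + 1) := by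
  have := h.tail_sum_le hD
  rw [Nat.choose_succ_succ', cascadeSum]
  omega

lemma IsSpread.lt_top {D n k c : ℕ} {a : ℕ → ℕ} (h : IsSpread D n (k + 1) a)
    (hn : D * c < n) : c < a 0 := by
  have := h.le_top
  exact lt_of_mul_lt_mul_left' (hn.trans_le this)

lemma IsSpread.kk_sum {D n k : ℕ} {a : ℕ → ℕ} (hD : 0 < D) (h : IsSpread D n (k + 1) a)
    (hn : D * k < n) :
    kk (k + 1) (cascadeSum (k + 1) a) =
      (a 0).choose k + kk k (cascadeSum k fun i => a (i + 1)) := by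
  have h1 := h.lt_top hn
  have h2 := Nat.choose_pos (show k + 1 ≤ a 0 by omega)
  rw [cascadeSum, kk_eq (by omega) (h.tail_sum_le hD)]

/-! ### Strict concavity at generic cascades -/

lemma choose_add_mul_le (b h j : ℕ) :
    b.choose (j + 1) + h * b.choose j ≤ (b + h).choose (j + 1) := by
  induction h with
  | zero => simp
  | succ h ih =>
    rw [← add_assoc, Nat.choose_succ_succ', add_mul, one_mul]
    have : b.choose j ≤ (b + h).choose j := Nat.choose_le_choose _ (by omega)
    omega

lemma kk_one_of_pos {m : ℕ} (hm : 0 < m) : kk 1 m = 1 := by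
  have := kk_eq (j := 0) (a := m) (m' := 0) (by simpa using hm) (by simp)
  simpa using this

/-- A graph with `m` edges has at least `kk 2 m` vertices, among which there are `m` pairs. -/
lemma le_choose_kk_two (m : ℕ) : m ≤ (kk 2 m).choose 2 := by
  rcases Nat.eq_zero_or_pos m with rfl | hm
  · simp
  obtain ⟨a, m', ha, hm', rfl⟩ := exists_choose_add (j := 1) hm
  rw [kk_eq_of_lt ha hm']
  rcases Nat.eq_zero_or_pos m' with rfl | h
  · simp
  · rw [kk_one_of_pos h, Nat.choose_one_right, Nat.choose_succ_succ' a 1, Nat.choose_one_right]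
    simp at hm'
    omega

/-- Strict concavity for graphs, in terms of numbers of vertices. -/
lemma choose_two_strict {D n a b x y : ℕ} (hD : 0 < D) (hn : 4 * D ^ 2 * (2 * D + 2) + D ≤ n)
    (han : a ≤ n) (hab : D * b + n ≤ D * a)
    (hx : b.choose 2 + (2 * D + 2) * n ≤ x.choose 2)
    (hy : b.choose 2 + (2 * D + 2) * n ≤ y.choose 2)
    (hxy : a.choose 2 + b.choose 2 < x.choose 2 + y.choose 2) : a + b + 1 < x + y := by
  by_contra hcon
  push Not at hcon
  have hbn : b ≤ n := by
    by_contra h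
    have : D * a ≤ D * b := Nat.mul_le_mul_left _ (by omega)
    have : 0 < n := by nlinarith
    omega
  have lower : ∀ x : ℕ, b.choose 2 + (2 * D + 2) * n ≤ x.choose 2 → b + 2 * D + 1 ≤ x := by
    intro x hx
    by_contra h
    have h1 : x.choose 2 ≤ (b + 2 * D).choose 2 := Nat.choose_le_choose _ (by omega)
    have h2 := hx.trans h1
    have h3 : (b.choose 2 + (2 * D + 2) * n : ℚ) ≤ (b + 2 * D : ℕ).choose 2 := by exact_mod_cast h2
    rw [Nat.cast_choose_two, Nat.cast_choose_two] at h3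
    push_cast at h3
    have h4 : (b : ℚ) ≤ n := by exact_mod_cast hbn
    have h5 : (4 * D ^ 2 * (2 * D + 2) + D : ℚ) ≤ n := by exact_mod_cast hn
    have h6 : (0 : ℚ) ≤ D := by positivity
    have h7 : (1 : ℚ) ≤ D := by exact_mod_cast hD
    nlinarith [mul_le_mul_of_nonneg_left h4 h6, mul_nonneg h6 h6]
  have hx1 := lower x hx
  have hy1 := lower y hy
  obtain ⟨p, rfl⟩ : ∃ p, x = b + p := ⟨x - b, by omega⟩
  obtain ⟨r, rfl⟩ : ∃ r, y = b + r := ⟨y - b, by omega⟩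
  have hp : 2 * D + 1 ≤ p := by omega
  have hr : 2 * D + 1 ≤ r := by omega
  have hxy' : (a.choose 2 + b.choose 2 : ℚ) < (b + p : ℕ).choose 2 + (b + r : ℕ).choose 2 := by
    exact_mod_cast hxy
  simp only [Nat.cast_choose_two] at hxy'
  push_cast at hxy'
  have hs : b + p + r ≤ a + 1 := by omega
  rcases hs.lt_or_eq with hlt | heq
  · have h1 : (b + p + r : ℚ) ≤ a := by exact_mod_cast Nat.lt_succ_iff.1 hlt
    have hp' : (1 : ℚ) ≤ p := by exact_mod_cast (by omega : 1 ≤ p)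
    have hr' : (1 : ℚ) ≤ r := by exact_mod_cast (by omega : 1 ≤ r)
    have hb' : (0 : ℚ) ≤ b := by positivity
    nlinarith [mul_pos (by linarith : (0:ℚ) < p) (by linarith : (0:ℚ) < r)]
  · have h1 : (b + p + r : ℚ) = a + 1 := by exact_mod_cast heq
    have h2 : (p * r : ℚ) < a := by
      have : (a : ℚ) = b + p + r - 1 := by linarith
      rw [this] at hxy' ⊢
      nlinarith
    have h3 : p * r < a := by exact_mod_cast h2
    have h4 : n + D ≤ D * (p + r) := by
      have : D * (b + p + r) = D * (a + 1) := by rw [heq]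
      nlinarith
    have h5 : D * (p + r) ≤ p * r := by
      nlinarith [Nat.mul_le_mul hp hr, mul_le_mul hp le_rfl (Nat.zero_le r) (Nat.zero_le p),
        mul_le_mul hr le_rfl (Nat.zero_le p) (Nat.zero_le r)]
    omega

lemma mul_le_of_scale {D n C h b : ℕ} (hD : 0 < D) (hh : n ≤ 2 * (D * h)) (hb : n ≤ D * b)
    (hn : 2 * D ^ 2 * C ≤ n) : C * n ≤ h * b := by
  have h1 : n * n ≤ 2 * (D * h) * (D * b) := Nat.mul_le_mul hh hb
  have h2 : 2 * D ^ 2 * C * n ≤ n * n := Nat.mul_le_mul_right _ hn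
  have h3 : (2 * D ^ 2) * (C * n) ≤ (2 * D ^ 2) * (h * b) := by
    calc (2 * D ^ 2) * (C * n) = 2 * D ^ 2 * C * n := by ring
      _ ≤ 2 * (D * h) * (D * b) := h2.trans h1
      _ = (2 * D ^ 2) * (h * b) := by ring
  exact le_of_mul_le_mul_left h3 (by positivity)

/-- Strict concavity of `kk` at generic cascades: if `x + y = C(a, j) + m` with a generic `m` and
`x`, `y` are not too close to `m`, then `kk j x + kk j y` exceeds `kk j C(a, j) + kk j m`. -/
lemma kk_strict {D n : ℕ} (hD : 0 < D) (j : ℕ)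
    (hn : 4 * D ^ 2 * (2 * D + 2) + D * (j + 5) ≤ n) {a : ℕ} {b : ℕ → ℕ} (han : a ≤ n)
    (hab : D * b 0 + n ≤ D * a) (hb : IsSpread D n (j + 2) b) {x y : ℕ}
    (hxy : x + y = a.choose (j + 2) + cascadeSum (j + 2) b)
    (hx : cascadeSum (j + 2) b + (2 * D + 2) * n ≤ x)
    (hy : cascadeSum (j + 2) b + (2 * D + 2) * n ≤ y) :
    a.choose (j + 1) + kk (j + 2) (cascadeSum (j + 2) b) < kk (j + 2) x + kk (j + 2) y := by
  induction j generalizing a b x y with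
  | zero =>
    have h1 : 0 < b 1 := hb.tail.lt_top (c := 0) (by nlinarith)
    rw [hb.kk_sum hD (by nlinarith)]
    simp only [cascadeSum, zero_add, Nat.choose_one_right, add_zero, one_add_one_eq_two] at *
    rw [kk_one_of_pos h1]
    have h2 := le_choose_kk_two x
    have h3 := le_choose_kk_two y
    have := choose_two_strict (D := D) (n := n) (a := a) (b := b 0) (x := kk 2 x) (y := kk 2 y)
      hD (by nlinarith) han hab (by omega) (by omega) (by omega)
    omega
  | succ j ih =>
    replace hb : IsSpread D n (j + 3) b := hb
    replace hxy : x + y = a.choose (j + 3) + cascadeSum (j + 3) b := hxy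
    replace hx : cascadeSum (j + 3) b + (2 * D + 2) * n ≤ x := hx
    replace hy : cascadeSum (j + 3) b + (2 * D + 2) * n ≤ y := hy
    change a.choose (j + 2) + kk (j + 3) (cascadeSum (j + 3) b) < kk (j + 3) x + kk (j + 3) y
    have hnj : D * (j + 6) ≤ n := (Nat.le_add_left (D * (j + 6)) _).trans hn
    have hnD : 4 * D ^ 2 * (2 * D + 2) ≤ n := by omega
    have hn' : 4 * D ^ 2 * (2 * D + 2) + D * (j + 5) ≤ n := by
      have : D * (j + 5) ≤ D * (j + 6) := Nat.mul_le_mul_left _ (by omega)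
      have hn2 : 4 * D ^ 2 * (2 * D + 2) + D * (j + 6) ≤ n := hn
      omega
    have hnj2 : D * (j + 4) < n := by
      have : D * (j + 4) < D * (j + 6) := Nat.mul_lt_mul_of_pos_left (by omega) hD
      omega
    have hnj3 : D * (j + 2) < n := by
      have : D * (j + 2) ≤ D * (j + 4) := Nat.mul_le_mul_left _ (by omega)
      omega
    have hn0 : 0 < n := by omega
    obtain ⟨A, rfl⟩ : ∃ A, a = A + 1 := by
      refine ⟨a - 1, ?_⟩
      rcases Nat.eq_zero_or_pos a with rfl | h
      · simp at hab
        omega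
      · omega
    have hbA : b 0 ≤ A := by
      have : b 0 < A + 1 := lt_of_mul_lt_mul_left' (by omega : D * b 0 < D * (A + 1))
      omega
    have htail := hb.tail
    have hgap := hb.1
    set m₁ := cascadeSum (j + 2) (fun i => b (i + 1)) with hm₁
    have hbig : j + 4 < b 0 := hb.lt_top hnj2
    have hbig1 : j + 4 < b 1 := htail.lt_top hnj2
    -- lower bounds for the distances between the binomial coefficients that occur
    have hE2 : m₁ + (2 * D + 2) * n ≤ (b 0).choose (j + 2) := by
      have h1 : m₁ ≤ (b 1 + 1).choose (j + 2) := htail.sum_le hD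
      obtain ⟨h, hh⟩ : ∃ h, b 0 = b 1 + 1 + h :=
        ⟨b 0 - b 1 - 1, by have := hb.succ_le hD; omega⟩
      have h2 : (b 1 + 1).choose (j + 2) + h * (b 1 + 1).choose (j + 1) ≤ (b 0).choose (j + 2) := by
        rw [hh]
        exact choose_add_mul_le (b 1 + 1) h (j + 1)
      have h3 : b 1 + 1 ≤ (b 1 + 1).choose (j + 1) := le_choose_of_lt (by omega) (by omega)
      have h4 : n ≤ D * h := by rw [hh] at hgap; nlinarith
      have h5 : n ≤ D * b 1 := htail.le_top
      have h6 : (2 * D + 2) * n ≤ h * (b 1 + 1) := by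
        have := mul_le_of_scale (C := 2 * D + 2) hD (show n ≤ 2 * (D * h) by omega) h5
          (by nlinarith only [hnD])
        have h8 : h * b 1 ≤ h * (b 1 + 1) := Nat.mul_le_mul_left _ (by omega)
        omega
      have h7 : h * (b 1 + 1) ≤ h * (b 1 + 1).choose (j + 1) := Nat.mul_le_mul_left _ h3
      omega
    have hE1 : (b 0).choose (j + 2) + (2 * D + 2) * n ≤ A.choose (j + 2) := by
      obtain ⟨h, rfl⟩ : ∃ h, A = b 0 + h := ⟨A - b 0, by omega⟩
      have h2 : (b 0).choose (j + 2) + h * (b 0).choose (j + 1) ≤ (b 0 + h).choose (j + 2) :=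
        choose_add_mul_le (b 0) h (j + 1)
      have h3 : b 0 ≤ (b 0).choose (j + 1) := le_choose_of_lt (by omega) (by omega)
      have h4 : n ≤ D * h + D := by nlinarith
      have h8 : n ≤ 2 * (D * h) := by
        have : D * 2 ≤ D * (j + 6) := Nat.mul_le_mul_left _ (by omega)
        omega
      have h5 : n ≤ D * b 0 := hb.le_top
      have h6 : (2 * D + 2) * n ≤ h * b 0 :=
        mul_le_of_scale hD h8 h5 (by nlinarith only [hnD])
      have h7 : h * b 0 ≤ h * (b 0).choose (j + 1) := Nat.mul_le_mul_left _ h3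
      omega
    have hA1 : (A + 1).choose (j + 3) = A.choose (j + 3) + A.choose (j + 2) := by
      rw [Nat.choose_succ_succ' A (j + 2), add_comm]
    have hA2 : (A + 1).choose (j + 2) = A.choose (j + 2) + A.choose (j + 1) := by
      rw [Nat.choose_succ_succ' A (j + 1), add_comm]
    have hpos := Nat.choose_pos (show j + 3 ≤ A by omega)
    have hsum : cascadeSum (j + 3) b = (b 0).choose (j + 3) + m₁ := rfl
    rw [show kk (j + 3) (cascadeSum (j + 3) b) = _ from hb.kk_sum hD hnj3, ← hm₁, hA2]
    rw [hsum] at hx hy hxy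
    have hgap' : D * b (0 + 1) + n ≤ D * A := by
      have : D * b 0 ≤ D * A := Nat.mul_le_mul_left _ hbA
      simp only [zero_add]
      omega
    -- the case in which one part contains the complete family on `A` points
    have side : ∀ x y, x + y = (A + 1).choose (j + 3) + ((b 0).choose (j + 3) + m₁) →
        A.choose (j + 3) ≤ x → (b 0).choose (j + 3) + m₁ + (2 * D + 2) * n ≤ y →
        y ≤ (A + 1).choose (j + 3) → x ≤ (A + 1).choose (j + 3) →
        A.choose (j + 2) + A.choose (j + 1) + ((b 0).choose (j + 2) + kk (j + 2) m₁) <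
          kk (j + 3) x + kk (j + 3) y := by
      intro x y hxy hAx hy hy' hx'
      obtain ⟨x', rfl⟩ : ∃ x', x = A.choose (j + 3) + x' := ⟨x - A.choose (j + 3), by omega⟩
      obtain ⟨g, rfl⟩ : ∃ g, y = (b 0).choose (j + 3) + m₁ + g :=
        ⟨y - ((b 0).choose (j + 3) + m₁), by omega⟩
      have hxg : x' + g = A.choose (j + 2) := by omega
      rw [show kk (j + 3) (A.choose (j + 3) + x') = A.choose (j + 2) + kk (j + 2) x' from
        kk_eq (j := j + 2) (Nat.add_pos_left hpos _) (by omega)]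
      obtain ⟨p, q, hpq, hp, hq, hp1, hq1, hle⟩ := kk_core_step (j := j + 2) (kk_subadd _)
        (show j + 2 + 1 ≤ b 0 by omega) hbA (show m₁ ≤ (b 0).choose (j + 2) by omega) hxg
      have := ih (a := A) (b := fun i => b (i + 1)) (x := p) (y := q) hn' (by omega) hgap' htail
        hpq (by omega) (by omega)
      rw [← hm₁] at this
      replace hle : (b 0).choose (j + 2) + (kk (j + 2) p + kk (j + 2) q) ≤
        kk (j + 2) x' + kk (j + 3) ((b 0).choose (j + 3) + m₁ + g) := hle
      omega
    rcases le_or_gt (A.choose (j + 3)) x with h | h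
    · exact side x y hxy h (by omega) (by omega) (by omega)
    rcases le_or_gt (A.choose (j + 3)) y with h' | h'
    · rw [add_comm (kk _ x)]
      exact side y x (by omega) h' (by omega) (by omega) (by omega)
    have h1 := kk_concave (j := j + 3) (a := A) (x := x) (y := y)
      (m := A.choose (j + 2) + ((b 0).choose (j + 3) + m₁)) h.le h'.le (by omega)
    have h2 := side (A.choose (j + 3)) (A.choose (j + 2) + ((b 0).choose (j + 3) + m₁))
      (by omega) le_rfl (by omega) (by omega) (by omega)
    omega

/-! ### Binomial decompositions and the Kruskal-Katona function -/

lemma IsBinomDecomp.tail {k m t : ℕ} {a : Fin (t + 2) → ℕ}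
    (h : IsBinomDecomp (k + 1) m (t + 1) a) :
    IsBinomDecomp k (m - (a 0).choose (k + 1)) t (Fin.tail a) := by
  have hsum := h.sum_eq
  rw [Fin.sum_univ_succ] at hsum
  refine ⟨fun i j hij => h.strictAnti (Fin.succ_lt_succ_iff.2 hij), ?_, ?_, ?_⟩
  · have := h.lt
    omega
  · have := h.le_last
    change k - t ≤ a (Fin.last (t + 1))
    omega
  · simp only [Fin.val_zero, tsub_zero] at hsum
    rw [← hsum, Nat.add_sub_cancel_left]
    refine Finset.sum_congr rfl fun j _ => ?_
    rw [Fin.tail, Fin.val_succ]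
    congr 1
    omega

lemma binomSum_succ (r : ℕ) {t : ℕ} (a : Fin (t + 2) → ℕ) :
    binomSum (r + 1 : ℕ) a = (a 0).choose (r + 1) + binomSum r (Fin.tail a) := by
  rw [binomSum, Fin.sum_univ_succ, binomSum]
  congr 1
  refine Finset.sum_congr rfl fun j _ => ?_
  simp only [Fin.val_succ, Fin.tail]
  push_cast
  have h2 : (r : ℤ) + 1 - (↑↑j + 1) = r - ↑↑j := by ring
  rw [h2]
  simp only [add_le_add_iff_right]

lemma binomSum_zero {t : ℕ} (a : Fin (t + 1) → ℕ) : binomSum 0 a = 1 := by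
  rw [binomSum, Fin.sum_univ_succ]
  have : ∀ x : Fin t, ¬ ((x : ℤ) + 1 ≤ 0) := fun x => by
    have : (0 : ℤ) ≤ (x : ℕ) := by positivity
    omega
  simp [this]

lemma binomSum_of_neg {r : ℤ} (hr : r < 0) {t : ℕ} (a : Fin (t + 1) → ℕ) : binomSum r a = 0 := by
  rw [binomSum]
  refine Finset.sum_eq_zero fun j _ => if_neg ?_
  have : (0 : ℤ) ≤ (j : ℕ) := by positivity
  omega

lemma IsBinomDecomp.le_apply_zero {k m t : ℕ} {a : Fin (t + 1) → ℕ} (h : IsBinomDecomp k m t a) :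
    k ≤ a 0 := by
  induction t generalizing k m with
  | zero => simpa using h.le_last
  | succ t ih =>
    obtain ⟨k, rfl⟩ : ∃ k', k = k' + 1 := ⟨k - 1, by have := h.lt; omega⟩
    have h1 := ih h.tail
    have h2 : a 1 < a 0 := h.strictAnti (by simp)
    simp only [Fin.tail, Fin.succ_zero_eq_one'] at h1
    omega

lemma IsBinomDecomp.lt_choose {k m t : ℕ} {a : Fin (t + 1) → ℕ} (h : IsBinomDecomp k m t a) :
    m < (a 0 + 1).choose k := by
  induction t generalizing k m with
  | zero =>
    have hk := h.le_apply_zero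
    have hlt := h.lt
    obtain ⟨k, rfl⟩ : ∃ k', k = k' + 1 := ⟨k - 1, by omega⟩
    have hs := h.sum_eq
    simp at hs
    rw [Nat.choose_succ_succ', ← hs]
    have := Nat.choose_pos (show k ≤ a 0 by omega)
    omega
  | succ t ih =>
    obtain ⟨k, rfl⟩ : ∃ k', k = k' + 1 := ⟨k - 1, by have := h.lt; omega⟩
    have h1 := ih h.tail
    have h2 : a 1 < a 0 := h.strictAnti (by simp)
    have h3 : (Fin.tail a 0 + 1).choose k ≤ (a 0).choose k := Nat.choose_le_choose _ h2
    rw [Nat.choose_succ_succ']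
    omega

/-- The lower bound of the Kruskal-Katona theorem is `kk k m`, whichever decomposition of `m` is
used. -/
lemma IsBinomDecomp.kk_eq_binomSum {k m t : ℕ} {a : Fin (t + 1) → ℕ}
    (h : IsBinomDecomp k m t a) : kk k m = binomSum (k - 1) a := by
  induction t generalizing k m with
  | zero =>
    have hk := h.le_apply_zero
    have hlt := h.lt
    obtain ⟨k, rfl⟩ : ∃ k', k = k' + 1 := ⟨k - 1, by omega⟩
    have hs := h.sum_eq
    simp at hs
    rw [← hs, kk_choose hk]
    simp [binomSum]
  | succ t ih =>
    have hlt := h.lt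
    obtain ⟨k, rfl⟩ : ∃ k', k = k' + 2 := ⟨k - 2, by omega⟩
    have h1 := ih h.tail
    have h2 : a 1 < a 0 := h.strictAnti (by simp)
    have h3 : (Fin.tail a 0 + 1).choose (k + 1) ≤ (a 0).choose (k + 1) :=
      Nat.choose_le_choose _ h2
    have h4 := h.tail.lt_choose
    have h5 : m = (a 0).choose (k + 2) + (m - (a 0).choose (k + 2)) := by
      have := h.sum_eq
      rw [Fin.sum_univ_succ] at this
      simp only [Fin.val_zero, tsub_zero] at this
      omega
    have h6 : 0 < (a 0).choose (k + 2) := Nat.choose_pos h.le_apply_zero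
    have h8 : m - (a 0).choose (k + 2) ≤ (a 0).choose (k + 1) := h4.le.trans h3
    rw [h5, kk_eq (Nat.add_pos_left h6 _) h8, h1]
    have h7 := binomSum_succ k a
    push_cast at h7 ⊢
    rw [show (k : ℤ) + 2 - 1 = k + 1 by ring, h7, show (k : ℤ) + 1 - 1 = k by ring]

/-! ### The Kruskal-Katona theorem -/

/-- If `I` is an initial segment of `r`-sets below `c`, then all `(r + 1)`-sets below `c`, followed by
the sets of `I` with `c` added, form an initial segment. -/
lemma isInitSeg_cone {N r : ℕ} {c : Fin N} {I : Finset (Finset (Fin N))}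
    (hI : Colex.IsInitSeg I r) (hsub : I ⊆ powersetCard r (Iio c)) :
    Colex.IsInitSeg (powersetCard (r + 1) (Iio c) ∪ I.image (insert c)) (r + 1) := by
  have hc : ∀ s ∈ I, c ∉ s := fun s hs hcs => by
    have := (mem_powersetCard.1 (hsub hs)).1 hcs
    simp at this
  refine ⟨?_, ?_⟩
  · intro s hs
    simp only [coe_union, coe_image, Set.mem_union, mem_coe, mem_powersetCard, Set.mem_image] at hs
    rcases hs with hs | ⟨s, hs, rfl⟩
    · exact hs.2
    · rw [card_insert_of_notMem (hc s hs), hI.1 hs]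
  · rintro s t hs ⟨hts, ht⟩
    simp only [mem_union, mem_powersetCard, mem_image] at hs ⊢
    rcases hs with hs | ⟨s, hs, rfl⟩
    · refine Or.inl ⟨fun x hx => mem_Iio.2 ?_, ht⟩
      exact Colex.forall_lt_mono hts.le (fun b hb => mem_Iio.1 (hs.1 hb)) x hx
    · have hle : ∀ b ∈ t, b ≤ c := by
        refine Colex.forall_le_mono hts.le fun b hb => ?_
        rcases mem_insert.1 hb with rfl | hb
        · exact le_rfl
        · exact (mem_Iio.1 ((mem_powersetCard.1 (hsub hs)).1 hb)).le
      by_cases hct : c ∈ t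
      · refine Or.inr ⟨t.erase c, ?_, insert_erase hct⟩
        refine hI.2 hs ⟨?_, by rw [card_erase_of_mem hct, ht]; rfl⟩
        have h1 : t = insert c (t.erase c) := (insert_erase hct).symm
        rw [← Colex.toColex_sdiff_lt_toColex_sdiff (u := {c}) (by simpa using hct) (by simp)] at hts
        rw [sdiff_singleton_eq_erase, sdiff_singleton_eq_erase, erase_insert (hc s hs)] at hts
        exact hts
      · refine Or.inl ⟨fun x hx => mem_Iio.2 ((hle x hx).lt_of_ne ?_), ht⟩
        rintro rfl
        exact hct hx

lemma shadow_powersetCard {α : Type*} [DecidableEq α] {r : ℕ} {B : Finset α} (h : r + 1 ≤ #B) :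
    shadow (powersetCard (r + 1) B) = powersetCard r B := by
  ext t
  rw [mem_shadow_iff_insert_mem]
  simp only [mem_powersetCard]
  constructor
  · rintro ⟨x, hx, h1, h2⟩
    rw [card_insert_of_notMem hx] at h2
    exact ⟨(subset_insert _ _).trans h1, by omega⟩
  · rintro ⟨h1, h2⟩
    obtain ⟨x, hx, hxt⟩ := exists_mem_notMem_of_card_lt_card (show #t < #B by omega)
    exact ⟨x, hxt, insert_subset hx h1, by rw [card_insert_of_notMem hxt, h2]⟩

lemma shadow_powersetCard_subset {α : Type*} [DecidableEq α] (r : ℕ) (B : Finset α) :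
    shadow (powersetCard (r + 1) B) ⊆ powersetCard r B := by
  intro t
  rw [mem_shadow_iff_insert_mem]
  simp only [mem_powersetCard]
  rintro ⟨x, hx, h1, h2⟩
  rw [card_insert_of_notMem hx] at h2
  exact ⟨(subset_insert _ _).trans h1, by omega⟩

lemma shadow_union {α : Type*} [DecidableEq α] (A B : Finset (Finset α)) :
    shadow (A ∪ B) = shadow A ∪ shadow B := by
  simp [shadow, sup_union]

lemma shadow_image_insert {α : Type*} [DecidableEq α] {c : α} {I : Finset (Finset α)}
    (hc : ∀ s ∈ I, c ∉ s) :
    shadow (I.image (insert c)) = I ∪ (shadow I).image (insert c) := by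
  ext t
  simp only [mem_shadow_iff, mem_union, mem_image, exists_exists_and_eq_and]
  constructor
  · rintro ⟨s, hs, x, hx, rfl⟩
    rcases eq_or_ne x c with rfl | hne
    · left
      rwa [erase_insert (hc s hs)]
    · right
      have hxs : x ∈ s := (mem_insert.1 hx).resolve_left hne
      exact ⟨s.erase x, ⟨s, hs, x, hxs, rfl⟩, (erase_insert_of_ne hne.symm).symm⟩
  · rintro (h | ⟨u, ⟨s, hs, x, hx, rfl⟩, rfl⟩)
    · exact ⟨t, h, c, mem_insert_self _ _, erase_insert (hc t h)⟩
    · refine ⟨s, hs, x, mem_insert_of_mem hx, ?_⟩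
      rw [erase_insert_of_ne]
      rintro rfl
      exact hc s hs hx

lemma card_union_image_insert {α : Type*} [DecidableEq α] {c : α} {A I : Finset (Finset α)}
    (hA : ∀ s ∈ A, c ∉ s) (hI : ∀ s ∈ I, c ∉ s) : #(A ∪ I.image (insert c)) = #A + #I := by
  rw [card_union_of_disjoint, card_image_of_injOn]
  · intro s hs t ht hst
    rw [← erase_insert (hI s hs), ← erase_insert (hI t ht)]
    exact congrArg (fun u => u.erase c) hst
  · rw [disjoint_left]
    intro s hs hs'
    obtain ⟨t, -, rfl⟩ := mem_image.1 hs'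
    exact hA _ hs (mem_insert_self _ _)

/-- The initial segments of the colex order have shadows of size `kk r m`. -/
lemma exists_initSeg_kk {N : ℕ} (a : ℕ) (ha : a ≤ N) (r m : ℕ) (hm : m ≤ a.choose r) :
    ∃ I : Finset (Finset (Fin N)), Colex.IsInitSeg I r ∧
      I ⊆ powersetCard r {i | (i : ℕ) < a} ∧ #I = m ∧ #(shadow I) = kk r m := by
  induction a generalizing r m with
  | zero =>
    rcases r with _ | r
    · simp at hm
      rcases (by omega : m = 0 ∨ m = 1) with rfl | rfl
      · exact ⟨∅, by simp⟩
      · refine ⟨{∅}, ⟨?_, ?_⟩, by simp⟩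
        · intro s hs
          simpa using hs
        · rintro s t - ⟨-, ht⟩
          simpa using ht
    · simp at hm
      exact ⟨∅, by simp [hm]⟩
  | succ a ih =>
    have hmono : ∀ r, powersetCard r ({i | (i : ℕ) < a} : Finset (Fin N)) ⊆
        powersetCard r {i | (i : ℕ) < a + 1} := fun r =>
      powersetCard_mono fun i hi => by simp at hi ⊢; omega
    rcases le_or_gt m (a.choose r) with h | h
    · obtain ⟨I, h1, h2, h3, h4⟩ := ih (by omega) r m h
      exact ⟨I, h1, h2.trans (hmono r), h3, h4⟩
    rcases r with _ | r
    · simp at hm h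
      omega
    rw [Nat.choose_succ_succ'] at hm
    obtain ⟨m', rfl⟩ : ∃ m', m = a.choose (r + 1) + m' := ⟨m - a.choose (r + 1), by omega⟩
    obtain ⟨I, h1, h2, h3, h4⟩ := ih (by omega) r m' (by omega)
    set c : Fin N := ⟨a, by omega⟩ with hc
    have hIio : ({i | (i : ℕ) < a} : Finset (Fin N)) = Iio c := by
      ext i
      simp [hc, Fin.lt_def]
    have hcard : #(Iio c) = a := by simp [hc]
    rw [hIio] at h2
    have hcI : ∀ s ∈ I, c ∉ s := fun s hs hcs => by
      have := (mem_powersetCard.1 (h2 hs)).1 hcs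
      simp at this
    have hcP : ∀ q, ∀ s ∈ powersetCard q (Iio c), c ∉ s := fun q s hs hcs => by
      have := (mem_powersetCard.1 hs).1 hcs
      simp at this
    have hcS : ∀ s ∈ shadow I, c ∉ s := fun s hs hcs => by
      obtain ⟨t, ht, hst⟩ := exists_subset_of_mem_shadow hs
      exact hcI t ht (hst hcs)
    refine ⟨_, isInitSeg_cone h1 h2, ?_, ?_, ?_⟩
    · refine union_subset ?_ ?_
      · rw [← hIio]
        exact hmono _
      · intro s hs
        obtain ⟨t, ht, rfl⟩ := mem_image.1 hs
        have ht' := mem_powersetCard.1 (h2 ht)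
        refine mem_powersetCard.2 ⟨insert_subset (by simp [hc]) ?_, ?_⟩
        · intro i hi
          have := mem_Iio.1 (ht'.1 hi)
          rw [Fin.lt_def] at this
          simp [hc] at this ⊢
          omega
        · rw [card_insert_of_notMem (hcI t ht), ht'.2]
    · rw [card_union_image_insert (hcP _) hcI, card_powersetCard, hcard, h3]
    · rw [shadow_union, shadow_image_insert hcI]
      have hra : r ≤ a := by
        by_contra hra
        rw [Nat.choose_eq_zero_of_lt (by omega : a < r)] at hm
        omega
      have hP : shadow (powersetCard (r + 1) (Iio c)) ∪ I = powersetCard r (Iio c) := by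
        rcases (by omega : r + 1 ≤ a ∨ a = r) with hr | hr
        · rw [shadow_powersetCard (by omega)]
          exact union_eq_left.2 h2
        · -- the only set of size `a` below `c` is in `I`
          have h5 : I = powersetCard r (Iio c) := by
            refine eq_of_subset_of_card_le h2 ?_
            rw [card_powersetCard, hcard, h3]
            subst hr
            simp at h ⊢
            omega
          rw [h5]
          exact union_eq_right.2 (shadow_powersetCard_subset r _)
      rw [← union_assoc, hP, card_union_image_insert (hcP _) hcS, card_powersetCard, hcard, h4,
        kk_eq (by omega) (by omega)]

/-- The **Kruskal-Katona theorem** in terms of `kk`. -/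
lemma kk_le_card_shadow {N k : ℕ} {S : Finset (Finset (Fin N))}
    (hS : (S : Set (Finset (Fin N))).Sized k) : kk k #S ≤ #(shadow S) := by
  have hle : #S ≤ N.choose k := by
    have := Set.Sized.card_le hS
    simpa using this
  obtain ⟨I, h1, -, h3, h4⟩ := exists_initSeg_kk N le_rfl k #S hle
  rw [← h4]
  exact kruskal_katona hS h3.le h1

/-! ### Links, deletions and shadows -/

section Families

variable {α : Type*} [DecidableEq α]

lemma sized_memberSubfamily {S : Finset (Finset α)} {k : ℕ}
    (hS : (S : Set (Finset α)).Sized (k + 1)) (x : α) :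
    (S.memberSubfamily x : Set (Finset α)).Sized k := by
  intro s hs
  rw [mem_coe, mem_memberSubfamily] at hs
  have := hS hs.1
  rw [card_insert_of_notMem hs.2] at this
  omega

lemma sized_nonMemberSubfamily {S : Finset (Finset α)} {k : ℕ}
    (hS : (S : Set (Finset α)).Sized k) (x : α) :
    (S.nonMemberSubfamily x : Set (Finset α)).Sized k := fun _ hs =>
  hS (mem_nonMemberSubfamily.1 hs).1

lemma nonMemberSubfamily_union_image_insert (S : Finset (Finset α)) (x : α) :
    S.nonMemberSubfamily x ∪ (S.memberSubfamily x).image (insert x) = S := by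
  rw [image_insert_memberSubfamily, nonMemberSubfamily, union_comm, filter_union_filter_not_eq]

lemma notMem_of_mem_memberSubfamily {S : Finset (Finset α)} {x : α} :
    ∀ s ∈ S.memberSubfamily x, x ∉ s := fun _ hs => (mem_memberSubfamily.1 hs).2

lemma notMem_of_mem_shadow {S : Finset (Finset α)} {x : α} (h : ∀ s ∈ S, x ∉ s) :
    ∀ s ∈ shadow S, x ∉ s := fun s hs hx => by
  obtain ⟨t, ht, hst⟩ := exists_subset_of_mem_shadow hs
  exact h t ht (hst hx)

lemma shadow_eq_link (S : Finset (Finset α)) (x : α) :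
    shadow S = (shadow (S.nonMemberSubfamily x) ∪ S.memberSubfamily x) ∪
      (shadow (S.memberSubfamily x)).image (insert x) := by
  conv_lhs => rw [← nonMemberSubfamily_union_image_insert S x]
  rw [shadow_union, shadow_image_insert notMem_of_mem_memberSubfamily, union_assoc]

lemma memberSubfamily_shadow (S : Finset (Finset α)) (x : α) :
    (shadow S).memberSubfamily x = shadow (S.memberSubfamily x) := by
  ext t
  simp only [mem_memberSubfamily, mem_shadow_iff_insert_mem]
  constructor
  · rintro ⟨⟨y, hy, h⟩, hx⟩
    rw [mem_insert, not_or] at hy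
    refine ⟨y, hy.2, by rwa [insert_comm], ?_⟩
    rw [mem_insert, not_or]
    exact ⟨fun h => hy.1 h.symm, hx⟩
  · rintro ⟨y, hy, h, hx⟩
    rw [mem_insert, not_or] at hx
    refine ⟨⟨y, ?_, by rwa [insert_comm]⟩, hx.2⟩
    rw [mem_insert, not_or]
    exact ⟨fun h => hx.1 h.symm, hy⟩

/-- The shadow of the deletion and the shadow of the link contribute disjointly to the shadow. -/
lemma card_shadow_nonMember_add_le (S : Finset (Finset α)) (x : α) :
    #(shadow (S.nonMemberSubfamily x)) + #(shadow (S.memberSubfamily x)) ≤ #(shadow S) := by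
  rw [← card_memberSubfamily_add_card_nonMemberSubfamily x (shadow S), memberSubfamily_shadow,
    add_comm]
  refine Nat.add_le_add_left (card_le_card fun t ht => ?_) _
  rw [mem_nonMemberSubfamily]
  refine ⟨shadow_mono (filter_subset _ _) ht, ?_⟩
  exact notMem_of_mem_shadow (fun s hs => (mem_nonMemberSubfamily.1 hs).2) t ht

lemma shadow_iterate_eq_link (S : Finset (Finset α)) (x : α) (j : ℕ) :
    shadow^[j + 1] S =
      (shadow^[j + 1] (S.nonMemberSubfamily x) ∪ shadow^[j] (S.memberSubfamily x)) ∪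
      (shadow^[j + 1] (S.memberSubfamily x)).image (insert x) := by
  have hx : ∀ j, ∀ s ∈ shadow^[j] (S.memberSubfamily x), x ∉ s := by
    intro j
    induction j with
    | zero => exact notMem_of_mem_memberSubfamily
    | succ j ih =>
      rw [Function.iterate_succ_apply']
      exact notMem_of_mem_shadow ih
  induction j with
  | zero => exact shadow_eq_link S x
  | succ j ih =>
    rw [Function.iterate_succ_apply', ih, shadow_union, shadow_union, shadow_image_insert (hx _)]
    simp only [← Function.iterate_succ_apply' (f := shadow)]
    rw [← union_assoc, union_assoc (shadow^[j + 1 + 1] _), union_self]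

lemma card_memberSubfamily_eq (S : Finset (Finset α)) (x : α) :
    #(S.memberSubfamily x) = #{s ∈ S | x ∈ s} := by
  rw [← image_insert_memberSubfamily, card_image_of_injOn]
  intro s hs t ht hst
  rw [← erase_insert (notMem_of_mem_memberSubfamily s hs),
    ← erase_insert (notMem_of_mem_memberSubfamily t ht)]
  exact congrArg (fun u => u.erase x) hst

/-- The degrees of a `k`-uniform family sum to `k` times its size. -/
lemma sum_card_memberSubfamily {S : Finset (Finset α)} {V : Finset α} {k : ℕ}
    (hS : S ⊆ powersetCard k V) : ∑ x ∈ V, #(S.memberSubfamily x) = k * #S := by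
  simp only [card_memberSubfamily_eq, card_filter]
  rw [sum_comm, mul_comm, ← smul_eq_mul, ← sum_const]
  refine sum_congr rfl fun s hs => ?_
  obtain ⟨h1, h2⟩ := mem_powersetCard.1 (hS hs)
  rw [← card_filter, filter_mem_eq_inter, inter_eq_right.2 h1, h2]

lemma card_supersets {V w : Finset α} {r : ℕ} (hw : w ∈ powersetCard r V) :
    #{t ∈ powersetCard (r + 1) V | w ⊆ t} = #V - r := by
  obtain ⟨h1, h2⟩ := mem_powersetCard.1 hw
  have : {t ∈ powersetCard (r + 1) V | w ⊆ t} = (V \ w).image fun x => insert x w := by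
    ext t
    simp only [mem_filter, mem_powersetCard, mem_image, mem_sdiff]
    constructor
    · rintro ⟨⟨h3, h4⟩, h5⟩
      obtain ⟨x, hx, hsub⟩ := (ssubset_iff_exists_cons_subset.1 (h5.ssubset_of_ne (by
        rintro rfl; omega)))
      have h6 := eq_of_subset_of_card_le hsub (by rw [card_cons]; omega)
      rw [cons_eq_insert] at h6
      exact ⟨x, ⟨h3 (h6 ▸ mem_insert_self _ _), hx⟩, h6⟩
    · rintro ⟨x, ⟨hx, hxw⟩, rfl⟩
      exact ⟨⟨insert_subset hx h1, by rw [card_insert_of_notMem hxw, h2]⟩, subset_insert _ _⟩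
  rw [this, card_image_of_injOn, card_sdiff_of_subset h1, h2]
  intro x hx y hy hxy
  have hxw : x ∉ w := (mem_sdiff.1 hx).2
  have : x ∈ insert y w := by
    rw [← show insert x w = insert y w from hxy]
    exact mem_insert_self _ _
  exact (mem_insert.1 this).resolve_right hxw

/-- If a family `W` of `(l + 2)`-sets has few cliques in the links of the points, then most sets in
its upper shadow contain at most `l + 1` members of `W`, so that the upper shadow is large. -/
lemma card_mul_le_of_few_cliques {V : Finset α} {l M : ℕ} {W T : Finset (Finset α)}
    (hW : W ⊆ powersetCard (l + 2) V)
    (hWT : ∀ t ∈ powersetCard (l + 3) V, ∀ w ∈ W, w ⊆ t → t ∈ T)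
    (hM : ∀ x ∈ V, ∀ Q : Finset (Finset α), (Q : Set (Finset α)).Sized (l + 2) →
      shadow Q ⊆ W.memberSubfamily x → #Q ≤ M) :
    #W * (#V - (l + 2)) ≤ (l + 1) * #T + 2 * (#V * M) := by
  set P := powersetCard (l + 3) V with hP
  set d : Finset α → ℕ := fun t => #{w ∈ W | w ⊆ t} with hd
  set bad := {t ∈ P | l + 2 ≤ d t} with hbad
  set Q : α → Finset (Finset α) := fun x =>
    {u ∈ powersetCard (l + 2) V | x ∉ u ∧ ∀ y ∈ u, insert x (u.erase y) ∈ W} with hQ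
  have hd' : ∀ t, d t = #{y ∈ t | t.erase y ∈ W} ∨ #t ≠ l + 3 := by
    intro t
    by_cases ht : #t = l + 3
    · left
      have : {w ∈ W | w ⊆ t} = ({y ∈ t | t.erase y ∈ W}).image fun y => t.erase y := by
        ext w
        simp only [mem_filter, mem_image]
        constructor
        · rintro ⟨hw, hwt⟩
          have hwc := (mem_powersetCard.1 (hW hw)).2
          obtain ⟨y, hy⟩ : (t \ w).Nonempty := by
            rw [← card_pos, card_sdiff_of_subset hwt]
            omega
          rw [mem_sdiff] at hy
          have : w = t.erase y := by
            refine eq_of_subset_of_card_le (subset_erase.2 ⟨hwt, hy.2⟩) ?_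
            rw [card_erase_of_mem hy.1]
            omega
          exact ⟨y, ⟨hy.1, this ▸ hw⟩, this.symm⟩
        · rintro ⟨y, ⟨-, h⟩, rfl⟩
          exact ⟨h, erase_subset _ _⟩
      rw [hd]
      simp only
      rw [this, card_image_of_injOn]
      exact (erase_injOn t).mono fun y hy => (mem_filter.1 hy).1
    · exact Or.inr ht
  have hsum : #W * (#V - (l + 2)) = ∑ t ∈ P, d t := by
    simp only [hd, card_filter]
    rw [sum_comm, ← smul_eq_mul, ← sum_const]
    refine sum_congr rfl fun w hw => ?_
    rw [← card_filter, ← card_supersets (hW hw)]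
  have hle : ∀ t ∈ P, d t ≤ (if t ∈ T then l + 1 else 0) + if t ∈ bad then 2 else 0 := by
    intro t ht
    have htc := (mem_powersetCard.1 ht).2
    by_cases htT : t ∈ T
    · rw [if_pos htT]
      by_cases hb : t ∈ bad
      · rw [if_pos hb, ((hd' t).resolve_right (by simpa using htc))]
        have := card_filter_le t fun y => t.erase y ∈ W
        omega
      · rw [if_neg hb]
        rw [hbad, mem_filter, not_and, not_le] at hb
        have := hb ht
        omega
    · have : d t = 0 := by
        rw [hd, card_eq_zero, filter_eq_empty_iff]
        exact fun w hw hwt => htT (hWT t ht w hw hwt)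
      omega
  have hbadQ : bad ⊆ V.biUnion fun x => (Q x).image (insert x) := by
    intro t ht
    rw [hbad, mem_filter] at ht
    obtain ⟨htV, htc⟩ := mem_powersetCard.1 ht.1
    have h1 := ht.2
    rw [(hd' t).resolve_right (by simpa using htc)] at h1
    -- at most one `(l + 2)`-subset of `t` is not in `W`
    obtain ⟨x, hx, hxy⟩ : ∃ x ∈ t, ∀ y ∈ t, y ≠ x → t.erase y ∈ W := by
      have h2 := card_filter_add_card_filter_not (s := t) fun y => t.erase y ∈ W
      have h3 : #{y ∈ t | ¬ t.erase y ∈ W} ≤ 1 := by omega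
      rcases Finset.eq_empty_or_nonempty {y ∈ t | ¬ t.erase y ∈ W} with h | ⟨x, hx⟩
      · obtain ⟨x, hx⟩ : t.Nonempty := by rw [← card_pos]; omega
        refine ⟨x, hx, fun y hy _ => ?_⟩
        have := filter_eq_empty_iff.1 h hy
        simpa using this
      · refine ⟨x, (mem_filter.1 hx).1, fun y hy hyx => ?_⟩
        by_contra hcon
        exact hyx (card_le_one.1 h3 y (mem_filter.2 ⟨hy, hcon⟩) x hx)
    refine mem_biUnion.2 ⟨x, htV hx, mem_image.2 ⟨t.erase x, ?_, insert_erase hx⟩⟩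
    rw [hQ, mem_filter, mem_powersetCard]
    refine ⟨⟨(erase_subset _ _).trans htV, by rw [card_erase_of_mem hx]; omega⟩,
      notMem_erase _ _, fun y hy => ?_⟩
    rw [mem_erase] at hy
    rw [erase_right_comm, insert_erase (mem_erase.2 ⟨hy.1.symm, hx⟩)]
    exact hxy y hy.2 hy.1
  have hbadc : #bad ≤ #V * M := by
    refine (card_le_card hbadQ).trans (card_biUnion_le.trans ?_)
    rw [← smul_eq_mul, ← sum_const]
    refine sum_le_sum fun x hx => card_image_le.trans (hM x hx (Q x) ?_ ?_)
    · intro u hu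
      exact (mem_powersetCard.1 (mem_filter.1 hu).1).2
    · intro w hw
      obtain ⟨u, hu, y, hy, rfl⟩ := mem_shadow_iff.1 hw
      rw [hQ, mem_filter] at hu
      exact mem_memberSubfamily.2 ⟨hu.2.2 y hy, fun h => hu.2.1 (mem_of_mem_erase h)⟩
  have h1 : ∑ t ∈ P, (if t ∈ T then l + 1 else 0) ≤ (l + 1) * #T := by
    rw [← sum_filter, sum_const, smul_eq_mul, mul_comm]
    exact Nat.mul_le_mul_left _ (card_le_card fun t ht => (mem_filter.1 ht).2)
  have h2 : ∑ t ∈ P, (if t ∈ bad then 2 else 0) ≤ 2 * #bad := by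
    rw [← sum_filter, sum_const, smul_eq_mul, mul_comm]
    exact Nat.mul_le_mul_left _ (card_le_card fun t ht => (mem_filter.1 ht).2)
  have h3 := sum_le_sum hle
  rw [sum_add_distrib] at h3
  omega

/-- A Bonferroni inequality for sets which pairwise meet in at most one point. -/
lemma sum_card_le_card_biUnion_add {β : Type*} [DecidableEq β] (W : Finset α)
    (N : α → Finset β) (h : ∀ w ∈ W, ∀ w' ∈ W, w ≠ w' → #(N w ∩ N w') ≤ 1) :
    ∑ w ∈ W, #(N w) ≤ #(W.biUnion N) + #W * #W := by
  induction W using Finset.induction_on with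
  | empty => simp
  | insert w W hw ih =>
    have ih' := ih fun u hu u' hu' => h u (mem_insert_of_mem hu) u' (mem_insert_of_mem hu')
    rw [sum_insert hw, biUnion_insert, card_insert_of_notMem hw]
    have h1 := card_union_add_card_inter (N w) (W.biUnion N)
    have h2 : #(N w ∩ W.biUnion N) ≤ #W := by
      rw [inter_biUnion]
      refine card_biUnion_le.trans ?_
      rw [card_eq_sum_ones]
      refine sum_le_sum fun u hu => h w (mem_insert_self _ _) u (mem_insert_of_mem hu) ?_
      rintro rfl
      exact hw hu
    nlinarith

section Missing

variable {S : Finset (Finset α)} {B : Finset α} {r : ℕ}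

lemma superset_notMem_of_missing {w t : Finset α} (hw : w ∈ powersetCard r B \ shadow S)
    (ht : t ∈ powersetCard (r + 1) B) (hwt : w ⊆ t) : t ∈ powersetCard (r + 1) B \ S := by
  rw [mem_sdiff] at hw ⊢
  refine ⟨ht, fun htS => hw.2 (mem_shadow_iff_exists_mem_card_add_one.2 ⟨t, htS, hwt, ?_⟩)⟩
  rw [(mem_powersetCard.1 ht).2, (mem_powersetCard.1 hw.1).2]

/-- All supersets in `B` of a set missing in the shadow are missing in the family. -/
lemma card_missing_shadow_mul_le (S : Finset (Finset α)) (B : Finset α) (r : ℕ) :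
    #(powersetCard r B \ shadow S) * (#B - r) ≤ (r + 1) * #(powersetCard (r + 1) B \ S) := by
  set W := powersetCard r B \ shadow S
  set T := powersetCard (r + 1) B \ S
  have h1 : #W * (#B - r) = ∑ w ∈ W, #{t ∈ T | w ⊆ t} := by
    rw [← smul_eq_mul, ← sum_const]
    refine sum_congr rfl fun w hw => ?_
    rw [← card_supersets (mem_sdiff.1 hw).1]
    congr 1
    ext t
    simp only [mem_filter]
    exact ⟨fun h => ⟨superset_notMem_of_missing hw h.1 h.2, h.2⟩,
      fun h => ⟨(mem_sdiff.1 h.1).1, h.2⟩⟩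
  rw [h1]
  simp only [card_filter]
  rw [sum_comm, mul_comm (r + 1), ← smul_eq_mul, ← sum_const]
  refine sum_le_sum fun t ht => ?_
  rw [← card_filter]
  have htc := (mem_powersetCard.1 (mem_sdiff.1 ht).1).2
  calc #{w ∈ W | w ⊆ t} ≤ #(powersetCard r t) := card_le_card fun w hw => by
        rw [mem_filter] at hw
        exact mem_powersetCard.2 ⟨hw.2, (mem_powersetCard.1 (mem_sdiff.1 hw.1).1).2⟩
    _ = r + 1 := by rw [card_powersetCard, htc, Nat.choose_succ_self_right]

/-- A version of `card_missing_shadow_mul_le` without the factor `r + 1`, at the price of an error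
term: two sets missing in the shadow have at most one common superset. -/
lemma card_missing_shadow_mul_le_add_sq (S : Finset (Finset α)) (B : Finset α) (r : ℕ) :
    #(powersetCard r B \ shadow S) * (#B - r) ≤ #(powersetCard (r + 1) B \ S) +
      #(powersetCard r B \ shadow S) * #(powersetCard r B \ shadow S) := by
  set W := powersetCard r B \ shadow S
  set T := powersetCard (r + 1) B \ S
  set N : Finset α → Finset (Finset α) := fun w => {t ∈ powersetCard (r + 1) B | w ⊆ t}
  have h1 : #W * (#B - r) = ∑ w ∈ W, #(N w) := by
    rw [← smul_eq_mul, ← sum_const]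
    exact sum_congr rfl fun w hw => (card_supersets (mem_sdiff.1 hw).1).symm
  have h2 : W.biUnion N ⊆ T := by
    intro t ht
    obtain ⟨w, hw, hwt⟩ := mem_biUnion.1 ht
    rw [mem_filter] at hwt
    exact superset_notMem_of_missing hw hwt.1 hwt.2
  have h3 := sum_card_le_card_biUnion_add W N fun w hw w' hw' hne => by
    -- a common superset is the union of the two sets
    rw [card_le_one]
    have key : ∀ t ∈ N w ∩ N w', t = w ∪ w' := by
      intro t ht
      rw [mem_inter, mem_filter, mem_filter, mem_powersetCard] at ht
      obtain ⟨⟨⟨-, htc⟩, hwt⟩, -, hwt'⟩ := ht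
      refine (eq_of_subset_of_card_le (union_subset hwt hwt') ?_).symm
      have hc := (mem_powersetCard.1 (mem_sdiff.1 hw).1).2
      have hc' := (mem_powersetCard.1 (mem_sdiff.1 hw').1).2
      have : #w < #(w ∪ w') := by
        refine card_lt_card (subset_union_left.ssubset_of_ne fun h => hne ?_)
        have : w' ⊆ w := by rw [h]; exact subset_union_right
        exact (eq_of_subset_of_card_le this (by omega)).symm
      omega
    exact fun t ht t' ht' => (key t ht).trans (key t' ht').symm
  have h4 := card_le_card h2
  omega

/-- A set missing in the second shadow would leave all its `#B - r` supersets missing in the shadow. -/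
lemma shadow_shadow_eq_of_few_missing (hS : S ⊆ powersetCard (r + 2) B)
    (hq : #(powersetCard (r + 1) B \ shadow S) < #B - r) :
    shadow (shadow S) = powersetCard r B := by
  apply Subset.antisymm
  · exact (shadow_mono ((shadow_mono hS).trans (shadow_powersetCard_subset _ _))).trans
      (shadow_powersetCard_subset _ _)
  · intro u hu
    by_contra hcon
    have : {t ∈ powersetCard (r + 1) B | u ⊆ t} ⊆ powersetCard (r + 1) B \ shadow S := by
      intro t ht
      rw [mem_filter] at ht
      refine mem_sdiff.2 ⟨ht.1, fun htS => hcon ?_⟩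
      refine mem_shadow_iff_exists_mem_card_add_one.2 ⟨t, htS, ht.2, ?_⟩
      rw [(mem_powersetCard.1 ht.1).2, (mem_powersetCard.1 hu).2]
    have := card_le_card this
    rw [card_supersets hu] at this
    omega

end Missing

end Families

/-! ### Numerical consequences of extremality -/

open Nat in
lemma pow_le_mul_choose {D n b r : ℕ} (hD : 0 < D) (h : n ≤ D * b) (hn : 2 * r * D ≤ n) :
    n ^ r ≤ (2 * D) ^ r * r ! * b.choose r := by
  have h1 : 2 * r ≤ b := by
    refine le_of_mul_le_mul_left (a := D) ?_ hD
    rw [mul_comm]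
    omega
  have h2 : (b + 1 - r) ^ r ≤ r ! * b.choose r := by
    rw [← descFactorial_eq_factorial_mul_choose]
    exact pow_sub_le_descFactorial b r
  calc n ^ r ≤ (2 * D * (b + 1 - r)) ^ r := by
        refine Nat.pow_le_pow_left (h.trans ?_) r
        rw [mul_comm 2, mul_assoc]
        exact Nat.mul_le_mul_left _ (by omega)
    _ = (2 * D) ^ r * (b + 1 - r) ^ r := mul_pow _ _ _
    _ ≤ _ := by rw [mul_assoc]; exact Nat.mul_le_mul_left _ h2

/-- `pow_le_mul_choose` with an unspecified constant. -/
lemma exists_pow_le_mul_choose {D : ℕ} (hD : 0 < D) (r : ℕ) :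
    ∃ K, 0 < K ∧ ∀ n b, 2 * r * D ≤ n → n ≤ D * b → n ^ r ≤ K * b.choose r :=
  ⟨_, by positivity, fun _ _ hn h => pow_le_mul_choose hD h hn⟩

/-- In a family attaining the Kruskal-Katona bound, a degree is close to either the size of the
remainder `m - C(a 0, k)` or to `C(a 0 - 1, k - 1)`. -/
lemma degree_dichotomy {D n : ℕ} (hD : 0 < D) (j : ℕ)
    (hn : 4 * D ^ 2 * (2 * D + 2) + D * (j + 5) ≤ n) {a : ℕ → ℕ} (ha : IsSpread D n (j + 3) a)
    (han : a 0 ≤ n) {d : ℕ} (hd0 : 0 < d) (hd : d ≤ cascadeSum (j + 3) a)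
    (h : kk (j + 3) (cascadeSum (j + 3) a - d) + kk (j + 2) d ≤
      kk (j + 3) (cascadeSum (j + 3) a)) :
    (cascadeSum (j + 2) (fun i => a (i + 1)) ≤ d ∧
      d ≤ cascadeSum (j + 2) (fun i => a (i + 1)) + (2 * D + 2) * n) ∨
    (a 0 - 1).choose (j + 2) ≤ d + (2 * D + 2) * n := by
  have hn' : D * (j + 5) ≤ n := le_trans (Nat.le_add_left _ _) hn
  have htop := ha.lt_top (c := j + 4) (by nlinarith)
  rw [ha.kk_sum hD (by nlinarith)] at h
  have hb := ha.tail
  have hle := ha.tail_sum_le hD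
  have hgap := ha.1
  rw [cascadeSum] at hd h
  set m' := cascadeSum (j + 2) (fun i => a (i + 1)) with hm'
  obtain ⟨p, hp⟩ : ∃ p, a 0 = p + 1 := ⟨a 0 - 1, by omega⟩
  rw [hp] at h hle hd hgap han
  rw [hp, Nat.add_sub_cancel]
  have hP1 : (p + 1).choose (j + 3) = p.choose (j + 2) + p.choose (j + 3) :=
    Nat.choose_succ_succ' p (j + 2)
  have hP2 : (p + 1).choose (j + 2) = p.choose (j + 1) + p.choose (j + 2) :=
    Nat.choose_succ_succ' p (j + 1)
  have hpos1 : 0 < (p + 1).choose (j + 3) := Nat.choose_pos (by omega)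
  have hpos2 : 0 < p.choose (j + 3) := Nat.choose_pos (by omega)
  by_contra hcon
  rw [not_or, not_and_or, not_le, not_le, not_le] at hcon
  obtain ⟨h1, h2⟩ := hcon
  rcases lt_or_ge d m' with hlt | hge
  · rw [show j + 2 + 1 = j + 3 from rfl] at hd h
    rw [show (p + 1).choose (j + 3) + m' - d = (p + 1).choose (j + 2 + 1) + (m' - d) by
        rw [show j + 2 + 1 = j + 3 from rfl]; omega,
      kk_eq (by omega) (by omega)] at h
    have := kk_subadd_strict (j + 1) (u := m' - d) (w := d) (by omega) hd0
    rw [Nat.sub_add_cancel hlt.le, show j + 1 + 1 = j + 2 from rfl] at this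
    omega
  · have h1' := h1.resolve_left (by omega)
    obtain ⟨e, rfl⟩ : ∃ e, d = m' + e := ⟨d - m', by omega⟩
    rw [show (p + 1).choose (j + 2 + 1) + m' - (m' + e) =
      p.choose (j + 2 + 1) + (p.choose (j + 2) - e) by
        rw [show j + 2 + 1 = j + 3 from rfl] at hd ⊢; omega, kk_eq (by omega) (by omega)] at h
    have := kk_strict hD j hn (a := p) (b := fun i => a (i + 1)) (x := p.choose (j + 2) - e)
      (y := m' + e) (by omega)
      (by
        change D * a 1 + n ≤ D * p
        rw [mul_add, mul_one] at hgap
        omega)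
      hb (by omega) (by omega) (by omega)
    rw [← hm'] at this
    omega

/-- If a size is close to `C(y, j + 1)` then the Kruskal-Katona bound is within a constant of
`C(y, j)`. -/
lemma choose_le_kk_add {D n K y j d : ℕ} (hyn : n ≤ D * (y - j)) (hy : j < y)
    (hd : d ≤ y.choose (j + 1)) (h : y.choose (j + 1) ≤ d + K * n) :
    y.choose j ≤ kk (j + 1) d + (j + 1) * K * D := by
  have h1 := kk_ratio hd
  have h2 := Nat.choose_succ_right_eq y j
  rw [Nat.add_sub_add_right] at h1
  refine le_of_mul_le_mul_right (a := y - j) ?_ (by omega)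
  calc y.choose j * (y - j) = (j + 1) * y.choose (j + 1) := by rw [← h2, mul_comm]
    _ ≤ (j + 1) * (d + K * n) := Nat.mul_le_mul_left _ h
    _ = (j + 1) * d + (j + 1) * K * n := by ring
    _ ≤ kk (j + 1) d * (y - j) + (j + 1) * K * (D * (y - j)) :=
        add_le_add h1 (Nat.mul_le_mul_left _ hyn)
    _ = _ := by ring

/-- Two numbers whose sum is almost `C(y, j + 1)` and which together have a small Kruskal-Katona
bound: if one of them is at most `C(y - z, j + 1)`, then it is very small. -/
lemma mul_le_of_kk_add_le {y z j x d e : ℕ} (hxd : x + d + e = y.choose (j + 1))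
    (hx : x ≤ (y - z).choose (j + 1)) (hk : kk (j + 1) x + kk (j + 1) d ≤ y.choose j) :
    z * x ≤ e * (y - j) := by
  have h1 := kk_ratio hx
  have h2 := kk_ratio (show d ≤ y.choose (j + 1) by omega)
  have h2' := kk_ratio (show x ≤ y.choose (j + 1) by omega)
  have h3 := Nat.choose_succ_right_eq y j
  rw [Nat.add_sub_add_right] at h1 h2 h2'
  rcases le_or_gt (y - j) z with hz | hz
  · rw [show y - z - j = 0 by omega, mul_zero] at h1
    have : x = 0 := by
      by_contra hx0
      have : 0 < (j + 1) * x := by positivity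
      omega
    simp [this]
  · obtain ⟨q, hq⟩ : ∃ q, y - j = q + z := ⟨y - j - z, by omega⟩
    rw [show y - z - j = q by omega] at h1
    rw [hq] at h2 h2' h3 ⊢
    set X := kk (j + 1) x
    set Y := kk (j + 1) d
    have h4 : (X + Y) * (q + z) ≤ (j + 1) * (x + d + e) := by
      rw [hxd, mul_comm (j + 1), h3]
      exact Nat.mul_le_mul_right _ hk
    have h5 : z * X ≤ (j + 1) * e := by nlinarith
    have h6 : (j + 1) * (z * x) ≤ (j + 1) * (e * (q + z)) := by
      calc (j + 1) * (z * x) = z * ((j + 1) * x) := by ring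
        _ ≤ z * (X * (q + z)) := Nat.mul_le_mul_left _ h2'
        _ = (z * X) * (q + z) := by ring
        _ ≤ ((j + 1) * e) * (q + z) := Nat.mul_le_mul_right _ h5
        _ = _ := by ring
    exact le_of_mul_le_mul_left h6 (by omega)

/-- A generic cascade absorbs a small excess `e` in its last two entries: the last but one, `a j`,
increases by `q`, and the last one takes up the remainder of `e`. This remainder fits because the
Kruskal-Katona bound increases by at most `q`. -/
lemma exists_spread_add {D n : ℕ} (hD : 0 < D) (j : ℕ) {a : ℕ → ℕ} (ha : IsSpread D n (j + 2) a)
    {q e K : ℕ} (hq : 2 * D * (q + 1) ≤ n) (he : q * a j + q.choose 2 ≤ e) (heK : e ≤ K * n)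
    (hK : D * D * K ≤ n) (hn : D * (j + 3) < n)
    (hk : kk (j + 2) (cascadeSum (j + 2) a + e) ≤ kk (j + 2) (cascadeSum (j + 2) a) + q) :
    ∃ b, IsSpread (2 * D) n (j + 2) b ∧ cascadeSum (j + 2) b = cascadeSum (j + 2) a + e ∧
      (∀ i < j, b i = a i) ∧ b 0 ≤ a 0 + q ∧
      kk (j + 2) (cascadeSum (j + 2) a) + q ≤ kk (j + 2) (cascadeSum (j + 2) a + e) := by
  induction j generalizing a with
  | zero =>
    have hkk := ha.kk_sum hD (by omega)
    obtain ⟨h1, h2⟩ := ha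
    have ha1 : 0 < a 1 := by
      by_contra h
      rw [show a 1 = 0 by omega] at h2
      omega
    have hk1 : kk 1 (a 1) = 1 := kk_one_of_pos ha1
    simp only [cascadeSum, zero_add, Nat.choose_one_right, add_zero, Nat.reduceAdd] at hkk hk ⊢
    rw [hk1] at hkk
    -- the bound on `kk` says that the new last entry is at most `a 0 + q`
    have h3 := (le_choose_kk_two _).trans (Nat.choose_le_choose 2 (hkk ▸ hk))
    have h4 : (a 0 + q).choose 2 = (a 0).choose 2 + q * a 0 + q.choose 2 := by
      rw [← Nat.cast_inj (R := ℚ)]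
      push_cast [Nat.cast_choose_two]
      ring
    have h5 : (a 0 + 1 + q).choose 2 = (a 0 + q) + (a 0 + q).choose 2 := by
      rw [show a 0 + 1 + q = a 0 + q + 1 by ring, Nat.choose_succ_succ', Nat.choose_one_right]
    set c := a 1 + e - (q * a 0 + q.choose 2) with hc
    refine ⟨fun i => if i = 0 then a 0 + q else c, ⟨?_, ?_⟩, ?_, by simp, by simp, ?_⟩
    · simp only [one_ne_zero, if_false, if_true]
      omega
    · simp only [one_ne_zero, if_false]
      calc n ≤ D * a 1 := h2
        _ ≤ 2 * D * c := Nat.mul_le_mul (by omega) (by omega)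
    · simp only [one_ne_zero, if_false, if_true]
      omega
    · rw [hkk, show (a 0).choose 2 + a 1 + e = (a 0 + q).choose 2 + c by omega,
        kk_eq (by omega) (by rw [Nat.choose_one_right]; omega),
        kk_one_of_pos (by omega), Nat.choose_one_right]
      omega
  | succ j ih =>
    have hroom0 : cascadeSum (j + 2) (fun i => a (i + 1)) + e ≤ (a 0).choose (j + 2) := by
      have h1 : cascadeSum (j + 2) (fun i => a (i + 1)) ≤ (a 1 + 1).choose (j + 2) :=
        ha.tail.sum_le hD
      have h2 := ha.1
      have h3 : n ≤ D * a 1 := ha.tail.le_top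
      have h4 : j + 1 < a 1 + 1 := by
        by_contra hcon
        have := h3.trans (Nat.mul_le_mul_left D (show a 1 ≤ j + 1 + 3 by omega))
        omega
      obtain ⟨h, hh⟩ : ∃ h, a 0 = a 1 + 1 + h := ⟨a 0 - (a 1 + 1), by
        have := le_of_mul_le_mul_left (a := D) (b := a 1 + 1) (c := a 0) (by linarith) hD
        omega⟩
      have h5 : n ≤ D * h := by rw [hh] at h2; linarith
      have h6 := le_choose_of_lt (r := j + 1) (by omega) h4
      have h7 := choose_add_mul_le (a 1 + 1) h (j + 1)
      have h8 : e ≤ h * (a 1 + 1) := by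
        refine le_of_mul_le_mul_left (a := D * D) ?_ (by positivity)
        calc D * D * e ≤ D * D * (K * n) := Nat.mul_le_mul_left _ heK
          _ = (D * D * K) * n := by ring
          _ ≤ n * n := Nat.mul_le_mul_right _ hK
          _ ≤ (D * h) * (D * (a 1 + 1)) :=
              Nat.mul_le_mul h5 (h3.trans (Nat.mul_le_mul_left _ (by omega)))
          _ = _ := by ring
      rw [hh]
      have h9 := Nat.mul_le_mul_left h h6
      simp only [show j + 1 + 1 = j + 2 from rfl] at h7
      omega
    have hpos : 0 < (a 0).choose (j + 3) :=
      Nat.choose_pos (by have := ha.lt_top (c := j + 3) (by nlinarith); omega)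
    have hkk := ha.kk_sum hD (by nlinarith)
    have hkk' : kk (j + 3) (cascadeSum (j + 3) a + e) = (a 0).choose (j + 2) +
        kk (j + 2) (cascadeSum (j + 2) (fun i => a (i + 1)) + e) := by
      rw [cascadeSum, add_assoc, kk_eq (Nat.add_pos_left hpos _) hroom0]
    rw [show j + 1 + 2 = j + 3 by ring, hkk', hkk] at hk
    obtain ⟨b, hb1, hb2, hb3, hb4, hb5⟩ := ih ha.tail he (by nlinarith) (by omega)
    refine ⟨fun i => if i = 0 then a 0 else b (i - 1), ⟨?_, ?_⟩, ?_, ?_, ?_, ?_⟩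
    · have := ha.1
      simp only [one_ne_zero, if_false, if_true, Nat.sub_self]
      have h6 : 2 * D * b 0 ≤ 2 * D * (a 1 + q) := Nat.mul_le_mul_left _ hb4
      nlinarith
    · simpa using hb1
    · change (a 0).choose (j + 3) + cascadeSum (j + 2) b =
        (a 0).choose (j + 3) + cascadeSum (j + 2) (fun i => a (i + 1)) + e
      rw [hb2, add_assoc]
    · intro i hi
      rcases Nat.eq_zero_or_pos i with rfl | hi0
      · simp
      · simp only
        rw [if_neg (by omega), hb3 (i - 1) (by omega), Nat.sub_add_cancel (by exact hi0)]
    · simp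
    · rw [show j + 1 + 2 = j + 3 by ring, hkk', hkk]
      omega

/-- The inequality which forces a vertex of small degree: on `v > a 0` vertices, the count of
`card_mul_le_of_few_cliques` fails. -/
lemma upper_shadow_count {b h l v m' s' : ℕ} (hm' : b.choose (l + 2) ≤ m')
    (hs' : s' ≤ b.choose (l + 1) + b.choose l) (hs'' : s' ≤ (b + h).choose (l + 1))
    (hv : b + h + 1 ≤ v) (hbl : l + 1 ≤ b) :
    ((b + h).choose (l + 2) + s') * (v - (l + 2)) + h.choose 2 * b.choose l ≤
      2 * v.choose (l + 3) + (l + 1) * ((b + h).choose (l + 3) + m') + (b + h) * b.choose l := by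
  induction v, hv using Nat.le_induction with
  | base =>
    have h1 := Nat.choose_succ_succ' (b + h) (l + 2)
    have h2 := Nat.choose_succ_right_eq (b + h) (l + 2)
    have h3 := Nat.choose_succ_right_eq b (l + 1)
    have h4 : b.choose (l + 2) + h * b.choose (l + 1) + h.choose 2 * b.choose l ≤
        (b + h).choose (l + 2) := by
      clear hs'' h1 h2
      induction h with
      | zero => simp
      | succ h ih =>
        have h5 := choose_add_mul_le b h l
        have h6 := Nat.choose_succ_succ' (b + h) (l + 1)
        have h7 := Nat.choose_succ_succ' h 1
        rw [Nat.choose_one_right] at h7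
        rw [← add_assoc, h6, h7]
        nlinarith
    obtain ⟨p, rfl⟩ : ∃ p, b = l + 1 + p := ⟨b - (l + 1), by omega⟩
    rw [show l + 1 + p + h + 1 - (l + 2) = p + h by omega]
    rw [show l + 1 + p - (l + 1) = p by omega] at h3
    have h2' : (l + 1 + p + h).choose (l + 3) * (l + 3) + (l + 1 + p + h).choose (l + 2) =
        (l + 1 + p + h).choose (l + 2) * (p + h) := by
      rcases Nat.eq_zero_or_pos (p + h) with h0 | h0
      · rw [h0, show l + 1 + p + h = l + 1 by omega]
        simp [Nat.choose_eq_zero_of_lt]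
      · rw [h2, ← mul_add_one]
        congr 1
        omega
    have h8 : s' * (p + h) ≤ ((l + 1 + p).choose (l + 1) + (l + 1 + p).choose l) * (p + h) :=
      Nat.mul_le_mul_right _ hs'
    rw [h1]
    have h9 := Nat.mul_le_mul_left (l + 1) hm'
    nlinarith
  | succ v hv ih =>
    have h1 : (v + 1).choose (l + 3) = v.choose (l + 2) + v.choose (l + 3) :=
      Nat.choose_succ_succ' v (l + 2)
    have h2 : (b + h).choose (l + 2) + s' ≤ v.choose (l + 2) := by
      refine le_trans ?_ (Nat.choose_le_choose _ hv)
      have : (b + h + 1).choose (l + 2) = (b + h).choose (l + 1) + (b + h).choose (l + 2) :=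
        Nat.choose_succ_succ' (b + h) (l + 1)
      omega
    rw [show v + 1 - (l + 2) = v - (l + 2) + 1 by omega, mul_add_one, h1]
    omega

/-! ### Vertices of small degree -/

section Families

variable {α : Type*} [DecidableEq α]

lemma memberSubfamily_nonMemberSubfamily (S : Finset (Finset α)) {x y : α} (h : y ≠ x) :
    (S.memberSubfamily y).nonMemberSubfamily x = (S.nonMemberSubfamily x).memberSubfamily y := by
  ext s
  simp only [mem_nonMemberSubfamily, mem_memberSubfamily, mem_insert, not_or]
  exact ⟨fun h1 => ⟨⟨h1.1.1, h.symm, h1.2⟩, h1.1.2⟩, fun h1 => ⟨⟨h1.1.1, h1.2⟩, h1.1.2.2⟩⟩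

/-- The set of points which are covered by a family. -/
def support [Fintype α] (S : Finset (Finset α)) : Finset α := {x | 0 < #(S.memberSubfamily x)}

lemma mem_support [Fintype α] {S : Finset (Finset α)} {x : α} :
    x ∈ support S ↔ 0 < #(S.memberSubfamily x) := by
  simp [support]

lemma subset_powersetCard_support [Fintype α] {S : Finset (Finset α)} {k : ℕ}
    (hS : (S : Set (Finset α)).Sized k) : S ⊆ powersetCard k (support S) := by
  intro s hs
  refine mem_powersetCard.2 ⟨fun x hx => mem_support.2 (card_pos.2 ⟨s.erase x, ?_⟩), hS hs⟩
  rw [mem_memberSubfamily, insert_erase hx]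
  exact ⟨hs, notMem_erase _ _⟩

lemma card_nonMemberSubfamily_eq (S : Finset (Finset α)) (x : α) :
    #(S.nonMemberSubfamily x) = #S - #(S.memberSubfamily x) := by
  have := card_memberSubfamily_add_card_nonMemberSubfamily x S
  omega

lemma card_memberSubfamily_le (S : Finset (Finset α)) (x : α) : #(S.memberSubfamily x) ≤ #S := by
  have := card_memberSubfamily_add_card_nonMemberSubfamily x S
  omega

lemma memberSubfamily_subset_powersetCard {S : Finset (Finset α)} {V : Finset α} {k : ℕ}
    (hS : S ⊆ powersetCard (k + 1) V) (x : α) :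
    S.memberSubfamily x ⊆ powersetCard k (V.erase x) := by
  intro s hs
  rw [mem_memberSubfamily] at hs
  obtain ⟨h1, h2⟩ := mem_powersetCard.1 (hS hs.1)
  rw [card_insert_of_notMem hs.2] at h2
  exact mem_powersetCard.2 ⟨subset_erase.2 ⟨(subset_insert _ _).trans h1, hs.2⟩, by omega⟩

end Families

/-- The numerical content of extremality at a point `x`. -/
lemma kk_deletion_add_kk_link_le {n k : ℕ} {S : Finset (Finset (Fin n))}
    (hS : (S : Set (Finset (Fin n))).Sized (k + 1)) (x : Fin n) :
    kk (k + 1) (#S - #(S.memberSubfamily x)) + kk k #(S.memberSubfamily x) ≤ #(shadow S) := by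
  rw [← card_nonMemberSubfamily_eq]
  exact (add_le_add (kk_le_card_shadow (sized_nonMemberSubfamily hS x))
    (kk_le_card_shadow (sized_memberSubfamily hS x))).trans (card_shadow_nonMember_add_le S x)

lemma card_le_choose_of_sized {n k : ℕ} {S : Finset (Finset (Fin n))}
    (hS : (S : Set (Finset (Fin n))).Sized k) : #S ≤ n.choose k := by
  have h : S ⊆ powersetCard k univ := fun s hs => mem_powersetCard.2 ⟨subset_univ _, hS hs⟩
  simpa using card_le_card h

lemma le_of_choose_lt {a v r : ℕ} (h : a.choose r < v.choose r) : a + 1 ≤ v := by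
  by_contra hcon
  have := Nat.choose_le_choose r (show v ≤ a by omega)
  omega

lemma choose_le_add_mul (b h j : ℕ) :
    (b + h).choose (j + 1) ≤ b.choose (j + 1) + h * (b + h).choose j := by
  induction h with
  | zero => simp
  | succ h ih =>
    rw [← add_assoc, Nat.choose_succ_succ', add_one_mul]
    have h1 : (b + h).choose j ≤ (b + h + 1).choose j := Nat.choose_le_choose _ (by omega)
    have h2 := Nat.mul_le_mul_left h h1
    omega

/-- A number whose Kruskal-Katona bound is `O(n ^ l)` is smaller than every fixed multiple of
`n ^ (l + 1)`. -/
lemma exists_mul_le_of_kk_le (l K E : ℕ) (hE : 0 < E) :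
    ∃ n₀, ∀ n ≥ n₀, ∀ q, kk (l + 2) q ≤ K * n ^ l → q * E ≤ K * n ^ (l + 1) := by
  obtain ⟨L, hL, hpow⟩ := exists_pow_le_mul_choose (D := 2 * E) (by positivity) (l + 1)
  refine ⟨2 * (l + 1) * (2 * E) + (L * K + 1) + 1, fun n hn q hq => ?_⟩
  have h1 : n ≤ 2 * E * (n / E) := by
    have h2 := Nat.lt_div_mul_add (a := n) hE
    have h3 : 1 ≤ n / E := (Nat.one_le_div_iff hE).2 (by nlinarith)
    nlinarith
  have h2 := hpow n (n / E) (by omega) h1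
  rcases le_or_gt q ((n / E).choose (l + 2)) with h | h
  · have h3 := kk_ratio h
    calc q * E ≤ (l + 2) * q * E := by nlinarith [Nat.zero_le (q * E)]
      _ ≤ K * n ^ l * (n / E) * E := by
          refine Nat.mul_le_mul_right _ (h3.trans (Nat.mul_le_mul hq ?_))
          generalize n / E = y
          omega
      _ ≤ K * n ^ l * n := by
          rw [mul_assoc]
          exact Nat.mul_le_mul_left _ (Nat.div_mul_le_self _ _)
      _ = _ := by ring
  · exfalso
    have h0 : l + 2 ≤ n / E := (Nat.le_div_iff_mul_le hE).2 (by nlinarith)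
    have h3 := kk_mono (l + 2) h.le
    rw [kk_choose h0] at h3
    have h4 : n ^ (l + 1) ≤ L * (K * n ^ l) := h2.trans (Nat.mul_le_mul_left _ (h3.trans hq))
    have h5 : n ^ l * n ≤ n ^ l * (L * K) := by
      calc n ^ l * n = n ^ (l + 1) := by ring
        _ ≤ _ := h4
        _ = _ := by ring
    have := le_of_mul_le_mul_left h5 (pow_pos (by omega) l)
    omega

/-- The surplus `C(h, 2) * C(b, l)` in `upper_shadow_count` exceeds the error terms if there are at
most `M` cliques in each link. -/
lemma margin_lt {D K₁ K₂ n l b h v M : ℕ} (hD : 0 < D) (hK₁ : 0 < K₁) (hK₂ : 0 < K₂)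
    (hn : 16 * D ^ 2 + 2 * D + 1 ≤ n) (hb : n ^ l ≤ K₂ * b.choose l) (hh : n ≤ D * h)
    (hv : v ≤ n) (hM : M * (32 * D ^ 2 * K₁ * K₂) ≤ K₁ * n ^ (l + 1)) :
    n * b.choose l + 2 * (v * M) < h.choose 2 * b.choose l := by
  set C := b.choose l
  have hn0 : 0 < n := by omega
  have hC : 0 < C := by
    by_contra h0
    rw [show C = 0 by omega, mul_zero] at hb
    have := pow_pos hn0 l
    omega
  have h2 : 2 ≤ h := by
    by_contra hcon
    have := hh.trans (Nat.mul_le_mul_left D (show h ≤ 1 by omega))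
    omega
  have h3 : n * n ≤ 4 * D ^ 2 * h.choose 2 := by
    obtain ⟨g, rfl⟩ : ∃ g, h = g + 2 := ⟨h - 2, by omega⟩
    have h4 := Nat.choose_succ_right_eq (g + 2) 1
    rw [Nat.choose_one_right] at h4
    have h5 : (g + 2) * (g + 2) ≤ 4 * (g + 2).choose 2 := by
      have : g + 2 - 1 = g + 1 := by omega
      rw [this] at h4
      nlinarith
    calc n * n ≤ (D * (g + 2)) * (D * (g + 2)) := Nat.mul_le_mul hh hh
      _ = D ^ 2 * ((g + 2) * (g + 2)) := by ring
      _ ≤ D ^ 2 * (4 * (g + 2).choose 2) := Nat.mul_le_mul_left _ h5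
      _ = _ := by ring
  have h6 : 16 * D ^ 2 * (2 * (v * M)) ≤ n * n * C := by
    refine le_of_mul_le_mul_left (a := K₁ * K₂) ?_ (by positivity)
    calc K₁ * K₂ * (16 * D ^ 2 * (2 * (v * M))) = v * (M * (32 * D ^ 2 * K₁ * K₂)) := by ring
      _ ≤ n * (K₁ * n ^ (l + 1)) := Nat.mul_le_mul hv hM
      _ = K₁ * (n * n) * n ^ l := by ring
      _ ≤ K₁ * (n * n) * (K₂ * C) := Nat.mul_le_mul_left _ hb
      _ = _ := by ring
  refine lt_of_mul_lt_mul_left (a := 16 * D ^ 2) ?_ (by positivity)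
  have h7 : 4 * (n * n * C) ≤ 16 * D ^ 2 * (h.choose 2 * C) := by
    calc 4 * (n * n * C) = 4 * C * (n * n) := by ring
      _ ≤ 4 * C * (4 * D ^ 2 * h.choose 2) := Nat.mul_le_mul_left _ h3
      _ = _ := by ring
  have h8 : 16 * D ^ 2 * (n * C) ≤ n * n * C := by
    calc 16 * D ^ 2 * (n * C) ≤ n * (n * C) := Nat.mul_le_mul_right _ (by omega)
      _ = _ := by ring
  have h9 : 0 < n * n * C := by positivity
  rw [mul_add]
  omega

/-- The hypotheses on a family in the structure theorem: it attains the Kruskal-Katona bound, and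
the entries of its cascade are far apart. -/
structure IsSpreadExtremal (D n k : ℕ) (a : ℕ → ℕ) (S : Finset (Finset (Fin n))) : Prop where
  sized : (S : Set (Finset (Fin n))).Sized k
  spread : IsSpread D n k a
  card_eq : #S = cascadeSum k a
  card_shadow_le : #(shadow S) ≤ kk k #S

section Structure

variable {D n l : ℕ} {a : ℕ → ℕ} {S : Finset (Finset (Fin n))}

lemma IsSpread.gap (h : IsSpread D n (l + 3) a) :
    n ≤ D * (a 0 - 1) ∧ D * a 1 + n ≤ D * (a 0 - 1) := by
  have := h.1
  rw [Nat.mul_sub, mul_one]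
  omega

lemma IsSpreadExtremal.top_le (hD : 0 < D) (hn : D * (l + 3) < n)
    (h : IsSpreadExtremal D n (l + 3) a S) : a 0 ≤ n := by
  have h1 := card_le_choose_of_sized h.sized
  rw [h.card_eq, cascadeSum] at h1
  have h2 := h.spread.lt_top hn
  by_contra hcon
  have h3 : n + 1 ≤ a 0 := by omega
  have h4 := Nat.choose_le_choose (l + 3) h3
  rw [Nat.choose_succ_succ'] at h4
  have h5 : 0 < n.choose (l + 2) := Nat.choose_pos (by nlinarith)
  simp only [show l + 2 + 1 = l + 3 from rfl] at h1 h4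
  omega

lemma IsSpreadExtremal.degree (hD : 0 < D) (hn : 4 * D ^ 2 * (2 * D + 2) + D * (l + 5) ≤ n)
    (h : IsSpreadExtremal D n (l + 3) a S) {x : Fin n} (hx : 0 < #(S.memberSubfamily x)) :
    (cascadeSum (l + 2) (fun i => a (i + 1)) ≤ #(S.memberSubfamily x) ∧
      #(S.memberSubfamily x) ≤ cascadeSum (l + 2) (fun i => a (i + 1)) + (2 * D + 2) * n) ∨
    (a 0 - 1).choose (l + 2) ≤ #(S.memberSubfamily x) + (2 * D + 2) * n := by
  refine degree_dichotomy hD l hn h.spread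
    (h.top_le hD (by nlinarith [Nat.zero_le (4 * D ^ 2 * (2 * D + 2))])) hx
    (h.card_eq ▸ card_memberSubfamily_le S x) ?_
  rw [← h.card_eq]
  exact (kk_deletion_add_kk_link_le h.sized x).trans h.card_shadow_le

end Structure

/-- If all degrees were close to `C(a 0 - 1, l + 2)`, few sets would be missing from the shadow in
the link of each point, and the number of sets would be too small. -/
lemma exists_degree_lt {D : ℕ} (hD : 0 < D) {l : ℕ} (hl : 1 ≤ l) :
    ∃ n₀, ∀ n ≥ n₀, ∀ (a : ℕ → ℕ) (S : Finset (Finset (Fin n))),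
      IsSpreadExtremal D n (l + 3) a S → ∃ x, 0 < #(S.memberSubfamily x) ∧
        #(S.memberSubfamily x) + (2 * D + 2) * n < (a 0 - 1).choose (l + 2) := by
  obtain ⟨K₀, hK₀, hpow₀⟩ := exists_pow_le_mul_choose hD (l + 2)
  obtain ⟨K₂, hK₂, hpow₂⟩ := exists_pow_le_mul_choose hD l
  set K₁ := l + 3 + (l + 2) * (2 * D + 2) * (2 * D) with hK₁
  have hK₁0 : 0 < K₁ := by omega
  -- any constant `E` is admissible in `exists_mul_le_of_kk_le`; this value is the one in `margin_lt`
  set E := 32 * D ^ 2 * K₁ * K₂ with hE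
  have hE0 : 0 < E := by positivity
  obtain ⟨n₁, hn₁⟩ := exists_mul_le_of_kk_le l K₁ E hE0
  refine ⟨n₁ + (4 * D ^ 2 * (2 * D + 2) + D * (l + 5)) + 2 * (l + 2) * (2 * D) +
    (16 * D ^ 2 + 2 * D + 1) + K₀ * (2 * D + 2) + 1, fun n hn a S hS => ?_⟩
  have hnn₁ : n₁ ≤ n := by omega
  have hnD : 4 * D ^ 2 * (2 * D + 2) + D * (l + 5) ≤ n := by omega
  have hnl : 2 * (l + 2) * (2 * D) ≤ n := by omega
  have hnm : 16 * D ^ 2 + 2 * D + 1 ≤ n := by omega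
  have hnK : K₀ * (2 * D + 2) < n := by omega
  have hDl (i : ℕ) (hi : i ≤ l + 4) : D * i < n := by
    have h1 : D * (l + 5) = D * (l + 4) + D := by ring
    have h2 := Nat.mul_le_mul_left D hi
    omega
  have hDl' (i : ℕ) (hi : i ≤ l + 2) : 2 * D * i ≤ n := by
    have h1 := Nat.mul_le_mul_left (2 * D) hi
    have h2 : 2 * (2 * D * (l + 2)) = 2 * (l + 2) * (2 * D) := by ring
    omega
  have hnl' := hDl (l + 4) le_rfl
  clear hn
  obtain ⟨hgap1, hgap2⟩ := hS.spread.gap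
  have han := hS.top_le hD (hDl _ (by omega))
  have ha0 := hS.spread.lt_top hnl'
  have hb0 := hS.spread.tail.lt_top hnl'
  have hbn : n ≤ D * a 1 := hS.spread.tail.le_top
  have hshadow := hS.card_shadow_le
  rw [hS.card_eq, hS.spread.kk_sum hD (hDl _ (by omega))] at hshadow
  have hm := hS.card_eq
  rw [cascadeSum] at hm
  have hm'1 := hS.spread.tail_sum_le hD
  have hm'2 : (a 1).choose (l + 2) ≤ cascadeSum (l + 2) fun i => a (i + 1) := by
    rw [cascadeSum]
    exact Nat.le_add_right _ _
  have hm'3 : cascadeSum (l + 2) (fun i => a (i + 1)) ≤ (a 0 - 1).choose (l + 2) := by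
    refine (hS.spread.tail.sum_le hD).trans (Nat.choose_le_choose _ ?_)
    have := lt_of_mul_lt_mul_left' (show D * a 1 < D * (a 0 - 1) by omega)
    exact this
  have hs' := hS.spread.tail.kk_sum hD (hDl _ (by omega))
  have hs'1 : kk (l + 2) (cascadeSum (l + 2) fun i => a (i + 1)) ≤
      (a 1).choose (l + 1) + (a 1).choose l := by
    rw [hs']
    refine Nat.add_le_add_left ?_ _
    have := kk_mono (l + 1) (hS.spread.tail.tail_sum_le hD)
    rwa [kk_choose (by exact hb0.le.trans' (by omega))] at this
  have hs'2 : kk (l + 2) (cascadeSum (l + 2) fun i => a (i + 1)) ≤ (a 0).choose (l + 1) := by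
    have := kk_mono (l + 2) hm'1
    rwa [kk_choose (by omega)] at this
  clear hs'
  set m' := cascadeSum (l + 2) fun i => a (i + 1) with hm'
  set s' := kk (l + 2) m'
  simp only [show l + 2 + 1 = l + 3 from rfl] at hm
  obtain ⟨p, hp⟩ : ∃ p, a 0 = p + 1 := ⟨a 0 - 1, by omega⟩
  rw [hp, Nat.add_sub_cancel] at hgap1 hgap2 hm'3
  rw [hp] at han ha0 hshadow hm hm'1 hs'2
  rw [hp, Nat.add_sub_cancel]
  by_contra! hcon
  have hn0 : 0 < n := by omega
  have hm'0 : 0 < m' := (Nat.choose_pos (by exact hb0.le.trans' (by omega))).trans_le hm'2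
  have hpA := hpow₀ n p (by rw [mul_right_comm]; exact hDl' _ le_rfl) hgap1
  have hA : (2 * D + 2) * n * n < p.choose (l + 2) := by
    refine lt_of_mul_lt_mul_left (a := K₀) ?_ (by positivity)
    calc K₀ * ((2 * D + 2) * n * n) = K₀ * (2 * D + 2) * n ^ 2 := by ring
      _ < n * n ^ 2 := Nat.mul_lt_mul_of_pos_right hnK (by positivity)
      _ = n ^ 3 := by ring
      _ ≤ n ^ (l + 2) := Nat.pow_le_pow_right hn0 (by omega)
      _ ≤ _ := hpA
  have hAp := Nat.add_one_mul_choose_eq p (l + 2)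
  simp only [show l + 2 + 1 = l + 3 from rfl] at hAp
  -- the number of points is close to `a 0`
  set V := support S with hV
  have hSV := subset_powersetCard_support hS.sized
  rw [← hV] at hSV
  have hvn : #V ≤ n := by simpa using card_le_univ V
  have hSv := card_le_card hSV
  rw [card_powersetCard] at hSv
  have hv1 : p + 1 + 1 ≤ #V := le_of_choose_lt (r := l + 3) (by omega)
  have hv2 : #V ≤ p + 1 + (l + 3) := by
    have h1 := sum_card_memberSubfamily hSV
    have h2 : #V * p.choose (l + 2) ≤ ∑ x ∈ V, (#(S.memberSubfamily x) + (2 * D + 2) * n) := by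
      rw [← smul_eq_mul, ← sum_const]
      exact sum_le_sum fun x hx => hcon x (mem_support.1 hx)
    rw [sum_add_distrib, h1, sum_const, smul_eq_mul, hm, mul_add] at h2
    by_contra hlt
    have h3 : #V * ((2 * D + 2) * n) ≤ (2 * D + 2) * n * n := by
      rw [mul_comm]
      exact Nat.mul_le_mul_left _ hvn
    have h4 := Nat.mul_le_mul_right (p.choose (l + 2)) (show p + 1 + (l + 3) + 1 ≤ #V by omega)
    have h5 := Nat.mul_le_mul_left (l + 3) hm'3
    rw [add_mul, add_mul, one_mul, hAp, mul_comm ((p + 1).choose _)] at h4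
    linarith
  -- few sets are missing in the link of each point
  set W := powersetCard (l + 2) V \ shadow S with hW
  set T := powersetCard (l + 3) V \ S with hT
  have hWx : ∀ x ∈ V, #(W.memberSubfamily x) ≤ K₁ * n ^ l := by
    intro x hx
    set d := #(S.memberSubfamily x) with hd
    have hdA := hcon x (mem_support.1 hx)
    have h1 : p.choose (l + 1) ≤ kk (l + 2) d + (l + 2) * (2 * D + 2) * (2 * D) := by
      rcases le_or_gt d (p.choose (l + 2)) with h | h
      · refine choose_le_kk_add (n := n) ?_ (by omega) h hdA
        have : 2 * D * (p - (l + 1)) = 2 * D * p - 2 * D * (l + 1) := Nat.mul_sub _ _ _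
        have h2 : 2 * D * (l + 1) ≤ n := hDl' _ (by omega)
        have h3 : 2 * D * p = 2 * (D * p) := mul_assoc _ _ _
        omega
      · have := kk_mono (l + 2) h.le
        rw [kk_choose (by omega)] at this
        omega
    have h2 : kk (l + 2) d ≤ #(shadow (S.memberSubfamily x)) :=
      kk_le_card_shadow (sized_memberSubfamily hS.sized x)
    have h3 : W.memberSubfamily x ⊆
        powersetCard (l + 1) (V.erase x) \ shadow (S.memberSubfamily x) := by
      rw [← memberSubfamily_shadow]
      intro s hs
      refine mem_sdiff.2 ⟨memberSubfamily_subset_powersetCard (by rw [hW]; exact sdiff_subset) x hs,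
        fun h => ?_⟩
      rw [mem_memberSubfamily] at hs h
      exact (mem_sdiff.1 hs.1).2 h.1
    have h4 : shadow (S.memberSubfamily x) ⊆ powersetCard (l + 1) (V.erase x) :=
      (shadow_mono (memberSubfamily_subset_powersetCard hSV x)).trans
        (shadow_powersetCard_subset _ _)
    have h5 := card_le_card h3
    rw [card_sdiff_of_subset h4, card_powersetCard, card_erase_of_mem hx] at h5
    obtain ⟨t, ht⟩ : ∃ t, #V - 1 = p + t := ⟨#V - 1 - p, by omega⟩
    have h6 := choose_le_add_mul p t l
    rw [ht] at h5
    have h7 : t * (p + t).choose l ≤ (l + 3) * n ^ l := by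
      refine Nat.mul_le_mul (by omega) ((Nat.choose_le_pow _ _).trans ?_)
      exact Nat.pow_le_pow_left (by omega) l
    have h8 : (l + 2) * (2 * D + 2) * (2 * D) * 1 ≤ (l + 2) * (2 * D + 2) * (2 * D) * n ^ l :=
      Nat.mul_le_mul_left _ (pow_pos hn0 l)
    rw [hK₁, add_mul]
    omega
  have hcount := card_mul_le_of_few_cliques (V := V) (l := l) (M := K₁ * n ^ (l + 1) / E) (W := W)
    (T := T) sdiff_subset
    (fun t ht w hw hwt => superset_notMem_of_missing hw ht hwt)
    (fun x hx Q hQ hQW => by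
      rw [Nat.le_div_iff_mul_le hE0]
      exact hn₁ n hnn₁ _ ((kk_le_card_shadow hQ).trans ((card_le_card hQW).trans (hWx x hx))))
  have hcW : #W + #(shadow S) = (#V).choose (l + 2) := by
    have h1 : shadow S ⊆ powersetCard (l + 2) V :=
      (shadow_mono hSV).trans (shadow_powersetCard_subset _ _)
    rw [hW, card_sdiff_add_card_eq_card h1, card_powersetCard]
  have hcT : #T + #S = (#V).choose (l + 3) := by
    rw [hT, card_sdiff_add_card_eq_card hSV, card_powersetCard]
  have hchoose := Nat.choose_succ_right_eq #V (l + 2)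
  simp only [show l + 2 + 1 = l + 3 from rfl] at hchoose
  obtain ⟨h, hh⟩ : ∃ h, p + 1 = a 1 + h := ⟨p + 1 - a 1, by
    have := lt_of_mul_lt_mul_left' (show D * a 1 < D * p by omega)
    omega⟩
  have hDh : n ≤ D * h := by
    have : D * (p + 1) = D * (a 1) + D * h := by rw [hh, mul_add]
    rw [mul_add, mul_one] at this
    omega
  have hupper := upper_shadow_count (b := a 1) (h := h) (l := l) (v := #V) hm'2 hs'1
    (by rwa [← hh]) (by omega) (by exact hb0.le.trans' (by omega))
  rw [← hh] at hupper
  have hmargin := margin_lt (l := l) (b := a 1) (h := h) (v := #V)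
    (M := K₁ * n ^ (l + 1) / E) hD hK₁0 hK₂ hnm
    (hpow₂ n (a 1) (by rw [mul_right_comm]; exact hDl' _ (by omega)) hbn) hDh hvn
    (Nat.div_mul_le_self _ _)
  set M := K₁ * n ^ (l + 1) / E
  set g := #V - (l + 2)
  have h1 : (p + 1) * (a 1).choose l ≤ n * (a 1).choose l := Nat.mul_le_mul_right _ han
  have h2 : #(shadow S) * g ≤ ((p + 1).choose (l + 2) + s') * g := Nat.mul_le_mul_right _ hshadow
  rw [hm] at hcT
  have h3 : #W * g + #(shadow S) * g = (#V).choose (l + 2) * g := by rw [← add_mul, hcW]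
  have h4 : (l + 1) * #T + (l + 1) * ((p + 1).choose (l + 3) + m') =
      (l + 1) * (#V).choose (l + 3) := by rw [← mul_add, hcT]
  rw [← hchoose] at h3
  have h5 : (#V).choose (l + 3) * (l + 3) = (l + 1) * (#V).choose (l + 3) +
      2 * (#V).choose (l + 3) := by ring
  linarith

/-- The numerical core of `exists_top_of_degree_le`: in the deletion of a point of small degree,
every degree is close to the largest possible value. -/
lemma choose_le_degree_add {p n l K C c e d : ℕ} (hp : p ≤ n) (hn : 2 * K ≤ n) (hK : 0 < K)
    (hc : n ^ (l + 2) ≤ K * c) (hcd : c ≤ 2 * d) (he : e ≤ C * n)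
    (hpos : l + 3 ≤ p)
    (hkk : kk (l + 3) ((p + 1).choose (l + 3) - e - d) + kk (l + 2) d ≤ (p + 1).choose (l + 2)) :
    p.choose (l + 2) ≤ d + (C + 4 * K * C) * n := by
  rcases le_or_gt (p.choose (l + 2)) (e + d) with h | h
  · nlinarith
  have h1 : (p + 1).choose (l + 3) = p.choose (l + 2) + p.choose (l + 3) :=
    Nat.choose_succ_succ' p (l + 2)
  have h2 : (p + 1).choose (l + 2) = p.choose (l + 1) + p.choose (l + 2) :=
    Nat.choose_succ_succ' p (l + 1)
  obtain ⟨x, hx⟩ : ∃ x, p.choose (l + 2) = x + d + e := ⟨p.choose (l + 2) - d - e, by omega⟩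
  have h0 : 0 < p.choose (l + 3) := Nat.choose_pos hpos
  rw [show (p + 1).choose (l + 3) - e - d = p.choose (l + 2 + 1) + x by
    rw [show l + 2 + 1 = l + 3 from rfl]; omega,
    kk_eq (by exact Nat.add_pos_left h0 _) (by omega), h2] at hkk
  -- `z` is of order `n`, but small enough for `x ≤ C(p - z, l + 2)`
  set z := n / (2 * K) with hz
  have hz1 : z * (2 * K) ≤ n := Nat.div_mul_le_self _ _
  have hz2 : n ≤ 4 * K * z := by
    have h3 := Nat.lt_div_mul_add (a := n) (b := 2 * K) (by positivity)
    have h4 : 1 ≤ n / (2 * K) := (Nat.one_le_div_iff (by positivity)).2 hn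
    rw [← hz] at h3 h4
    nlinarith
  have hzp : z * n ^ (l + 1) ≤ d := by
    refine le_of_mul_le_mul_left (a := 2 * K) ?_ (by positivity)
    calc 2 * K * (z * n ^ (l + 1)) = (z * (2 * K)) * n ^ (l + 1) := by ring
      _ ≤ n * n ^ (l + 1) := Nat.mul_le_mul_right _ hz1
      _ = n ^ (l + 2) := by ring
      _ ≤ K * c := hc
      _ ≤ K * (2 * d) := Nat.mul_le_mul_left _ hcd
      _ = _ := by ring
  have hxz : x ≤ (p - z).choose (l + 2) := by
    rcases le_or_gt z p with hzp' | hzp'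
    · obtain ⟨g, rfl⟩ : ∃ g, p = g + z := ⟨p - z, by omega⟩
      have h3 := choose_le_add_mul g z (l + 1)
      have h4 : (g + z).choose (l + 1) ≤ n ^ (l + 1) :=
        (Nat.choose_le_pow _ _).trans (Nat.pow_le_pow_left hp _)
      have h5 := Nat.mul_le_mul_left z h4
      rw [Nat.add_sub_cancel]
      simp only [show l + 1 + 1 = l + 2 from rfl] at h3
      omega
    · exfalso
      have h3 : p * n ^ (l + 1) ≤ z * n ^ (l + 1) := Nat.mul_le_mul_right _ hzp'.le
      have h4 : p ^ (l + 2) ≤ p * n ^ (l + 1) := by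
        rw [pow_succ']
        exact Nat.mul_le_mul_left _ (Nat.pow_le_pow_left hp _)
      have := Nat.choose_le_pow p (l + 2)
      omega
  have h3 := mul_le_of_kk_add_le (j := l + 1) hx.symm hxz (by
    rw [show l + 1 + 1 = l + 2 from rfl]
    omega)
  have h4 : x ≤ 4 * K * C * n := by
    refine le_of_mul_le_mul_left (a := n) ?_ (by omega)
    calc n * x ≤ 4 * K * z * x := Nat.mul_le_mul_right _ hz2
      _ = 4 * K * (z * x) := by ring
      _ ≤ 4 * K * (C * n * n) := by
          refine Nat.mul_le_mul_left _ (h3.trans (Nat.mul_le_mul he ?_))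
          omega
      _ = _ := by ring
  rw [add_mul]
  omega

/-- The deletion of a point whose degree is close to the remainder `m - C(a 0, k)` lives on exactly
`a 0` points, and so does its link. -/
lemma exists_top_of_degree_le {D : ℕ} (hD : 0 < D) {l : ℕ} (hl : 1 ≤ l) :
    ∃ n₀, ∀ n ≥ n₀, ∀ (a : ℕ → ℕ) (S : Finset (Finset (Fin n))),
      IsSpreadExtremal D n (l + 3) a S → ∀ (x : Fin n) (e : ℕ),
        #(S.memberSubfamily x) = cascadeSum (l + 2) (fun i => a (i + 1)) + e →
        e ≤ (2 * D + 2) * n →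
        ∃ B, #B = a 0 ∧ S.nonMemberSubfamily x ⊆ powersetCard (l + 3) B ∧
          S.memberSubfamily x ⊆ powersetCard (l + 2) B ∧ x ∉ B := by
  obtain ⟨K, hK, hpow⟩ := exists_pow_le_mul_choose hD (l + 2)
  set C := 2 * D + 2 with hC
  set C' := C + 4 * K * C with hC'
  refine ⟨(4 * D ^ 2 * (2 * D + 2) + D * (l + 5)) + 2 * (l + 2) * D + 2 * K * (C + 1) + K * C' + 1,
    fun n hn a S hS x e he heC => ?_⟩
  have hnD : 4 * D ^ 2 * (2 * D + 2) + D * (l + 5) ≤ n := by omega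
  have hnl : 2 * (l + 2) * D ≤ n := by omega
  have hnK : 2 * K * (C + 1) ≤ n := by omega
  have hnC' : K * C' < n := by omega
  clear hn
  have hDl (i : ℕ) (hi : i ≤ l + 4) : D * i < n := by
    have h1 : D * (l + 5) = D * (l + 4) + D := by ring
    have h2 := Nat.mul_le_mul_left D hi
    omega
  have hn0 : 0 < n := (Nat.zero_le _).trans_lt (hDl _ le_rfl)
  obtain ⟨hgap1, hgap2⟩ := hS.spread.gap
  have han := hS.top_le hD (hDl _ (by omega))
  have ha0 := hS.spread.lt_top (hDl _ le_rfl)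
  have hbn : n ≤ D * a 1 := hS.spread.tail.le_top
  have hshadow := hS.card_shadow_le
  rw [hS.card_eq, hS.spread.kk_sum hD (hDl _ (by omega))] at hshadow
  have hm := hS.card_eq
  rw [cascadeSum] at hm
  have hdeg := fun y => hS.degree (x := y) hD hnD
  have hm'2 : (a 1).choose (l + 2) ≤ cascadeSum (l + 2) fun i => a (i + 1) := by
    rw [cascadeSum]
    exact Nat.le_add_right _ _
  have hc := hpow n (a 1) hnl hbn
  have hab := lt_of_mul_lt_mul_left' (show D * a 1 < D * (a 0 - 1) by omega)
  set m' := cascadeSum (l + 2) fun i => a (i + 1) with hm'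
  simp only [show l + 2 + 1 = l + 3 from rfl] at hm
  obtain ⟨p, hp⟩ : ∃ p, a 0 = p + 1 := ⟨a 0 - 1, by omega⟩
  rw [hp, Nat.add_sub_cancel] at hab
  rw [hp] at han ha0 hshadow hm
  simp only [hp, Nat.add_sub_cancel, ← hC] at hdeg
  rw [hp]
  have hcA : (a 1).choose (l + 2) ≤ p.choose (l + 2) := Nat.choose_le_choose _ hab.le
  have hA : C' * n * n < p.choose (l + 2) := by
    refine lt_of_mul_lt_mul_left (a := K) ?_ (by positivity)
    calc K * (C' * n * n) = K * C' * n ^ 2 := by ring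
      _ < n * n ^ 2 := Nat.mul_lt_mul_of_pos_right hnC' (by positivity)
      _ = n ^ 3 := by ring
      _ ≤ n ^ (l + 2) := Nat.pow_le_pow_right hn0 (by omega)
      _ ≤ _ := hc
      _ ≤ _ := Nat.mul_le_mul_left _ hcA
  have hsmall : 2 * (C * n + n ^ (l + 1)) ≤ (a 1).choose (l + 2) := by
    refine le_of_mul_le_mul_left (a := K) ?_ (by positivity)
    calc K * (2 * (C * n + n ^ (l + 1))) ≤ K * (2 * (C * n ^ (l + 1) + n ^ (l + 1))) := by
          gcongr
          exact Nat.le_self_pow (by omega) n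
      _ = 2 * K * (C + 1) * n ^ (l + 1) := by ring
      _ ≤ n * n ^ (l + 1) := Nat.mul_le_mul_right _ hnK
      _ = n ^ (l + 2) := by ring
      _ ≤ _ := hc
  have hpow0 : 0 < n ^ (l + 1) := pow_pos hn0 _
  have heA : e < p.choose (l + 2) := by
    have : C * n ≤ C' * n := Nat.mul_le_mul_right _ (by omega)
    have : C' * n * 1 ≤ C' * n * n := Nat.mul_le_mul_left _ hn0
    omega
  -- the deletion
  have hp1 : (p + 1).choose (l + 3) = p.choose (l + 2) + p.choose (l + 3) :=
    Nat.choose_succ_succ' p (l + 2)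
  set R := S.nonMemberSubfamily x with hR
  have hRs : (R : Set (Finset (Fin n))).Sized (l + 3) := sized_nonMemberSubfamily hS.sized x
  have hRc : #R = (p + 1).choose (l + 3) - e := by
    rw [hR, card_nonMemberSubfamily_eq, he, hm]
    omega
  have hRsh : #(shadow R) ≤ (p + 1).choose (l + 2) := by
    have h1 := card_shadow_nonMember_add_le S x
    have h2 := kk_le_card_shadow (sized_memberSubfamily hS.sized x)
    have h3 := kk_mono (l + 2) (show m' ≤ #(S.memberSubfamily x) by omega)
    rw [← hR] at h1
    omega
  -- a point loses at most a codegree when `x` is deleted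
  have hRdeg : ∀ y, y ≠ x → 0 < #(S.memberSubfamily y) →
      (a 1).choose (l + 2) ≤ 2 * #(R.memberSubfamily y) := by
    intro y hyx hy
    have h1 := card_memberSubfamily_add_card_nonMemberSubfamily x (S.memberSubfamily y)
    rw [memberSubfamily_nonMemberSubfamily S hyx, ← hR] at h1
    have h2 := card_le_choose_of_sized
      (sized_memberSubfamily (sized_memberSubfamily hS.sized y) x)
    have h3 := Nat.choose_le_pow n (l + 1)
    have h4 := hdeg y hy
    rcases h4 with h4 | h4 <;> omega
  have hRle : ∀ y, #(R.memberSubfamily y) ≤ #(S.memberSubfamily y) := fun y =>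
    card_le_card fun s hs => by
      rw [mem_memberSubfamily] at hs ⊢
      exact ⟨(mem_nonMemberSubfamily.1 hs.1).1, hs.2⟩
  have hRx : #(R.memberSubfamily x) = 0 := by
    rw [hR, Finset.memberSubfamily_nonMemberSubfamily, card_empty]
  have hRtop : ∀ y ∈ support R, p.choose (l + 2) ≤ #(R.memberSubfamily y) + C' * n := by
    intro y hy
    rw [mem_support] at hy
    have hyx : y ≠ x := by
      rintro rfl
      omega
    refine choose_le_degree_add (by omega) (by nlinarith) hK hc
      (hRdeg y hyx (hy.trans_le (hRle y))) heC (by omega) ?_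
    rw [← hRc]
    exact (kk_deletion_add_kk_link_le hRs y).trans hRsh
  have hRsub := subset_powersetCard_support hRs
  have hBn : #(support R) ≤ n := by simpa using card_le_univ (support R)
  have hAp := Nat.add_one_mul_choose_eq p (l + 2)
  simp only [show l + 2 + 1 = l + 3 from rfl] at hAp
  have hB1 : #(support R) ≤ p + 1 := by
    by_contra hlt
    have h1 := sum_card_memberSubfamily hRsub
    have h2 : #(support R) * p.choose (l + 2) ≤
        ∑ y ∈ support R, (#(R.memberSubfamily y) + C' * n) := by
      rw [← smul_eq_mul, ← sum_const]
      exact sum_le_sum hRtop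
    rw [sum_add_distrib, h1, sum_const, smul_eq_mul] at h2
    have h3 : #(support R) * (C' * n) ≤ C' * n * n := by
      rw [mul_comm]
      exact Nat.mul_le_mul_left _ hBn
    have h4 := Nat.mul_le_mul_right (p.choose (l + 2)) (show p + 1 + 1 ≤ #(support R) by omega)
    have h5 := Nat.mul_le_mul_left (l + 3) (show #R ≤ (p + 1).choose (l + 3) by omega)
    rw [add_mul, one_mul, hAp, mul_comm ((p + 1).choose _)] at h4
    omega
  have hB2 : p + 1 ≤ #(support R) := by
    refine le_of_choose_lt (r := l + 3) ?_
    have h1 := card_le_card hRsub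
    rw [card_powersetCard] at h1
    omega
  have hxB : x ∉ support R := by
    rw [mem_support]
    omega
  refine ⟨support R, by omega, hRsub, ?_, hxB⟩
  have h1 := memberSubfamily_subset_powersetCard (subset_powersetCard_support hS.sized) x
  refine h1.trans (powersetCard_mono fun y hy => ?_)
  rw [mem_erase, mem_support] at hy
  rw [mem_support]
  have := hRdeg y hy.1 hy.2
  omega

/-! ### The structure of fourth shadows -/

section Cascade

variable {α : Type*} [DecidableEq α]

/-- A family of `r`-sets has cascade structure with entries `a 0, a 1, …` if it consists of all
`r`-subsets of an `a 0`-set `B` and of the sets `insert x t`, for some `x ∉ B`, with `t` in a family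
of `(r - 1)`-subsets of `B` which has cascade structure with entries `a 1, a 2, …`. The recursion
ends with the family `{∅}`. -/
def IsCascade : ℕ → (ℕ → ℕ) → Finset (Finset α) → Prop
  | 0, _, F => F = {∅}
  | r + 1, a, F => ∃ (B : Finset α) (x : α) (F' : Finset (Finset α)), #B = a 0 ∧ x ∉ B ∧
      F' ⊆ powersetCard r B ∧ IsCascade r (fun i => a (i + 1)) F' ∧
      F = powersetCard (r + 1) B ∪ F'.image (insert x)

lemma IsCascade.congr {r : ℕ} {a b : ℕ → ℕ} {F : Finset (Finset α)} (h : IsCascade r a F)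
    (hab : ∀ i < r, a i = b i) : IsCascade r b F := by
  induction r generalizing a b F with
  | zero => exact h
  | succ r ih =>
    obtain ⟨B, x, F', h1, h2, h3, h4, h5⟩ := h
    exact ⟨B, x, F', h1.trans (hab 0 (by omega)), h2, h3,
      ih h4 fun i hi => hab (i + 1) (by omega), h5⟩

lemma shadow_iterate_subset_powersetCard {T : Finset (Finset α)} {B : Finset α} {r j : ℕ}
    (h : T ⊆ powersetCard (r + j) B) : shadow^[j] T ⊆ powersetCard r B := by
  induction j generalizing T with
  | zero => exact h
  | succ j ih =>
    rw [Function.iterate_succ_apply]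
    exact ih ((shadow_mono h).trans (shadow_powersetCard_subset _ _))

lemma shadow_iterate_eq_singleton {S : Finset (Finset α)} {k : ℕ}
    (hS : (S : Set (Finset α)).Sized k) (h : S.Nonempty) : shadow^[k] S = {∅} := by
  obtain ⟨s, hs⟩ := h
  ext t
  rw [mem_shadow_iterate_iff_exists_mem_card_add, mem_singleton]
  constructor
  · rintro ⟨u, hu, -, h⟩
    rw [hS hu] at h
    exact card_eq_zero.1 (by omega)
  · rintro rfl
    exact ⟨s, hs, empty_subset _, by rw [hS hs, card_empty, zero_add]⟩

end Cascade

lemma IsSpread.apply_le {D n k : ℕ} {a : ℕ → ℕ} (hD : 0 < D) (h : IsSpread D n k a) :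
    ∀ i < k, a i ≤ a 0 := by
  induction k generalizing a with
  | zero => simp
  | succ k ih =>
    intro i hi
    rcases Nat.eq_zero_or_pos i with rfl | hi0
    · exact le_rfl
    obtain ⟨i, rfl⟩ : ∃ i', i = i' + 1 := ⟨i - 1, by omega⟩
    have h1 : a (i + 1) ≤ a 1 := ih h.tail i (by omega)
    match k, h with
    | 0, h => omega
    | 1, h => exact h1.trans h.1
    | k + 2, h => exact h1.trans (by have := h.succ_le hD; omega)

/-- The fourth shadow of an extremal family with a generic cascade has cascade structure. -/
theorem exists_isCascade (l : ℕ) {D : ℕ} (hD : 0 < D) :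
    ∃ n₀, ∀ n ≥ n₀, ∀ (a : ℕ → ℕ) (S : Finset (Finset (Fin n))),
      IsSpreadExtremal D n (l + 4) a S → IsCascade l a (shadow^[4] S) := by
  induction l generalizing D with
  | zero =>
    refine ⟨D * 4 + 1, fun n hn a S hS => shadow_iterate_eq_singleton hS.sized ?_⟩
    rw [← card_pos, hS.card_eq, cascadeSum]
    have := Nat.choose_pos (hS.spread.lt_top (c := 4) (by omega)).le
    simp only [Nat.reduceAdd]
    omega
  | succ l ih =>
    obtain ⟨n₁, hn₁⟩ := exists_degree_lt hD (l := l + 2) (by omega)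
    obtain ⟨n₂, hn₂⟩ := exists_top_of_degree_le hD (l := l + 2) (by omega)
    -- the cascade of a link is slightly less spread than the one of the family
    obtain ⟨n₃, hn₃⟩ := ih (D := 2 * D) (by omega)
    set C := 2 * D + 2 with hC
    set Q := (l + 5) * C * (2 * D) with hQ
    refine ⟨n₁ + n₂ + n₃ + (4 * D ^ 2 * C + D * (l + 2 + 5)) + 2 * D * (2 * Q + l + 6) + D * D * C,
      fun n hn a S hS => ?_⟩
    have h1n : n₁ ≤ n := by omega
    have h2n : n₂ ≤ n := by omega
    have h3n : n₃ ≤ n := by omega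
    have hnD : 4 * D ^ 2 * C + D * (l + 2 + 5) ≤ n := by omega
    have hnQ : 2 * D * (2 * Q + l + 6) ≤ n := by omega
    have hnC : D * D * C ≤ n := by omega
    clear hn
    have hDl (i : ℕ) (hi : i ≤ l + 6) : D * i < n := by
      have h1 : D * (l + 2 + 5) = D * (l + 6) + D := by ring
      have h2 := Nat.mul_le_mul_left D hi
      omega
    have hn0 : 0 < n := (Nat.zero_le _).trans_lt (hDl _ le_rfl)
    obtain ⟨x, hx0, hx⟩ := hn₁ n h1n a S hS
    obtain ⟨hgap1, hgap2⟩ := hS.spread.gap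
    obtain ⟨hd1, hd2⟩ := (hS.degree hD hnD hx0).resolve_right (by rw [← hC]; omega)
    rw [← hC] at hd2
    have ha0 := hS.spread.lt_top (hDl _ le_rfl)
    have hDa0 := hS.spread.le_top
    set m' := cascadeSum (l + 2 + 2) fun i => a (i + 1) with hm'
    obtain ⟨e, he⟩ : ∃ e, #(S.memberSubfamily x) = m' + e :=
      ⟨#(S.memberSubfamily x) - m', by omega⟩
    have heC : e ≤ C * n := by omega
    obtain ⟨B, hB, hR, hL, hxB⟩ := hn₂ n h2n a S hS x e he heC
    have hm := hS.card_eq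
    have hshadow := hS.card_shadow_le
    rw [hS.card_eq, hS.spread.kk_sum hD (hDl _ (by omega))] at hshadow
    rw [cascadeSum] at hm
    set R := S.nonMemberSubfamily x with hRdef
    have hcR := card_memberSubfamily_add_card_nonMemberSubfamily x S
    rw [← hRdef] at hcR
    have hT : #(powersetCard (l + 5) B \ R) = e := by
      rw [card_sdiff_of_subset hR, card_powersetCard, hB]
      simp only [show l + 2 + 2 + 1 = l + 5 from rfl, show l + 1 + 3 = l + 4 from rfl] at hm hm' he
      simp only [show l + 2 + 3 = l + 5 from rfl]
      omega
    -- the sets which are missing in the shadow of the deletion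
    have hq1 := card_missing_shadow_mul_le R B (l + 4)
    have hq2 := card_missing_shadow_mul_le_add_sq R B (l + 4)
    have hcsh : #(powersetCard (l + 4) B \ shadow R) + #(shadow R) = (a 0).choose (l + 4) := by
      rw [card_sdiff_add_card_eq_card
        ((shadow_mono hR).trans (shadow_powersetCard_subset _ _)), card_powersetCard, hB]
    have hRR := shadow_shadow_eq_of_few_missing (r := l + 3)
      (show R ⊆ powersetCard (l + 3 + 2) B from hR)
    simp only [show l + 4 + 1 = l + 5 from rfl, hT] at hq1 hq2
    rw [hB] at hq1 hq2 hRR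
    simp only [show l + 3 + 1 = l + 4 from rfl] at hRR
    set q := #(powersetCard (l + 4) B \ shadow R) with hq
    have hqQ : q ≤ Q := by
      refine le_of_mul_le_mul_right (a := n) ?_ hn0
      have h1 : n ≤ 2 * D * (a 0 - (l + 4)) := by
        rw [Nat.mul_sub, mul_assoc, mul_assoc]
        have := hDl (l + 4) (by omega)
        have h2 := Nat.mul_le_mul_left (2 * D) (show l + 4 ≤ 2 * Q + l + 6 by omega)
        have h3 : D * (2 * Q + l + 6) = D * (l + 4) + D * (2 * Q + 2) := by ring
        have h4 := mul_assoc 2 D (2 * Q + l + 6)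
        omega
      calc q * n ≤ q * (2 * D * (a 0 - (l + 4))) := Nat.mul_le_mul_left _ h1
        _ = 2 * D * (q * (a 0 - (l + 4))) := by ring
        _ ≤ 2 * D * ((l + 5) * (C * n)) :=
            Nat.mul_le_mul_left _ (hq1.trans (Nat.mul_le_mul_left _ heC))
        _ = _ := by rw [hQ]; ring
    have hgap : a 1 + (2 * q + l + 5) ≤ a 0 - 1 := by
      refine le_of_mul_le_mul_left (a := D) ?_ hD
      have h1 := Nat.mul_le_mul_left D (show 2 * q + l + 5 ≤ 2 * Q + l + 6 by omega)
      have h2 := mul_assoc 2 D (2 * Q + l + 6)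
      rw [mul_add]
      omega
    have hbl : a (l + 3) ≤ a 1 := hS.spread.tail.apply_le hD (l + 2) (by omega)
    have heq : q * a (l + 3) + q.choose 2 ≤ e := by
      have h1 : q.choose 2 ≤ q * q := by
        rw [← sq]
        exact Nat.choose_le_pow q 2
      have h2 : q * (a (l + 3) + 2 * q) ≤ q * (a 0 - (l + 4)) := Nat.mul_le_mul_left _ (by omega)
      nlinarith
    have hRR' : shadow (shadow R) = powersetCard (l + 3) B := hRR (by omega)
    have hsum := card_shadow_nonMember_add_le S x
    rw [← hRdef] at hsum
    have hLkk := kk_le_card_shadow (sized_memberSubfamily hS.sized x)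
    simp only [show l + 1 + 3 = l + 4 from rfl] at hshadow hLkk hm'
    rw [← hm'] at hshadow
    obtain ⟨b, hb1, hb2, hb3, -, hb5⟩ := exists_spread_add hD (l + 2) hS.spread.tail (q := q)
      (e := e) (K := C)
      ((Nat.mul_le_mul_left _ (by omega)).trans hnQ) heq heC hnC (hDl _ (by omega)) (by
        rw [← he]
        simp only [show l + 2 + 2 = l + 4 from rfl]
        rw [← hm']
        omega)
    simp only [show l + 2 + 2 = l + 4 from rfl] at hb1 hb2 hb5 he
    rw [← hm'] at hb2 hb5
    have hlink : IsSpreadExtremal (2 * D) n (l + 4) b (S.memberSubfamily x) :=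
      ⟨sized_memberSubfamily hS.sized x, hb1, by omega, by rw [he]; omega⟩
    refine ⟨B, x, shadow^[4] (S.memberSubfamily x), hB, hxB,
      shadow_iterate_subset_powersetCard hL,
      (hn₃ n h3n b _ hlink).congr fun i hi => hb3 i (by omega), ?_⟩
    have hR4 : shadow^[3 + 1] R = powersetCard (l + 1) B := by
      rw [show 3 + 1 = 2 + 1 + 1 from rfl, Function.iterate_succ_apply, Function.iterate_succ_apply,
        hRR', Function.iterate_succ_apply', Function.iterate_one,
        shadow_powersetCard (by omega), shadow_powersetCard (by omega)]
    have hL3 : shadow^[3] (S.memberSubfamily x) ⊆ powersetCard (l + 1) B :=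
      shadow_iterate_subset_powersetCard hL
    rw [shadow_iterate_eq_link S x 3, ← hRdef, hR4, union_eq_left.2 hL3]

/-! ### Cascade structure and initial segments of the colex order -/

/-- A permutation which maps `A` to an initial interval can be changed outside `A` so that it also
maps a further point to the next number. -/
lemma exists_perm_insert {N : ℕ} {σ : Equiv.Perm (Fin N)} {A : Finset (Fin N)} {x : Fin N}
    (hσ : A.image σ = ({i | i.val < #A} : Finset (Fin N))) (hx : x ∉ A) :
    ∃ τ : Equiv.Perm (Fin N), (∀ y ∈ A, τ y = σ y) ∧ (τ x).val = #A ∧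
      (insert x A).image τ = ({i | i.val < #(insert x A)} : Finset (Fin N)) := by
  have hAN : #A < N := by
    have h1 := card_le_univ (insert x A)
    rw [card_insert_of_notMem hx, Fintype.card_fin] at h1
    omega
  have hmem : ∀ y, y ∈ A ↔ (σ y).val < #A := by
    intro y
    have h1 : σ y ∈ A.image σ ↔ y ∈ A := by simp
    rw [← h1, hσ]
    simp
  set c : Fin N := ⟨#A, hAN⟩ with hc
  have hfix : ∀ y ∈ A, (σ.trans (Equiv.swap (σ x) c)) y = σ y := by
    intro y hy
    rw [Equiv.trans_apply, Equiv.swap_apply_of_ne_of_ne]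
    · exact fun h => hx (σ.injective h ▸ hy)
    · intro h
      have h1 := (hmem y).1 hy
      rw [h] at h1
      simp [hc] at h1
  refine ⟨σ.trans (Equiv.swap (σ x) c), hfix, by simp [hc], ?_⟩
  rw [image_insert, image_congr (g := σ) fun y hy => hfix y hy, hσ, card_insert_of_notMem hx]
  ext i
  simp only [Equiv.trans_apply, Equiv.swap_apply_left, mem_insert, mem_filter, mem_univ, true_and,
    Fin.ext_iff, hc]
  omega

lemma exists_perm_extend {N : ℕ} {σ : Equiv.Perm (Fin N)} {A B : Finset (Fin N)}
    (hσ : A.image σ = ({i | i.val < #A} : Finset (Fin N))) (hAB : A ⊆ B) :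
    ∃ τ : Equiv.Perm (Fin N), (∀ y ∈ A, τ y = σ y) ∧
      B.image τ = ({i | i.val < #B} : Finset (Fin N)) := by
  suffices h : ∀ E : Finset (Fin N), ∃ τ : Equiv.Perm (Fin N), (∀ y ∈ A, τ y = σ y) ∧
      (E ∪ A).image τ = ({i | i.val < #(E ∪ A)} : Finset (Fin N)) by
    have := h B
    rwa [union_eq_left.2 hAB] at this
  intro E
  induction E using Finset.induction_on with
  | empty => exact ⟨σ, fun _ _ => rfl, by rwa [empty_union]⟩
  | insert x E _ ih =>
    obtain ⟨τ, h1, h2⟩ := ih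
    rw [insert_union]
    by_cases hx : x ∈ E ∪ A
    · rw [insert_eq_of_mem hx]
      exact ⟨τ, h1, h2⟩
    · obtain ⟨τ', h3, -, h4⟩ := exists_perm_insert h2 hx
      exact ⟨τ', fun y hy => (h3 y (mem_union_right _ hy)).trans (h1 y hy), h4⟩

lemma image_image_powersetCard {N : ℕ} (σ : Equiv.Perm (Fin N)) (r : ℕ) (B : Finset (Fin N)) :
    (powersetCard r B).image (Finset.image σ) = powersetCard r (B.image σ) := by
  have h := powersetCard_map σ.toEmbedding r B
  rw [map_eq_image, map_eq_image] at h
  have h2 : (mapEmbedding σ.toEmbedding).toEmbedding = (Finset.image σ : Finset (Fin N) → _) := by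
    funext s
    simp [mapEmbedding, map_eq_image]
  rw [h2] at h
  exact h.symm

lemma IsCascade.nonempty {α : Type*} [DecidableEq α] {r : ℕ} {a : ℕ → ℕ}
    {F : Finset (Finset α)} (h : IsCascade r a F) : F.Nonempty := by
  induction r generalizing a F with
  | zero => rw [show F = {∅} from h]; exact singleton_nonempty _
  | succ r ih =>
    obtain ⟨B, x, F', -, -, -, h4, rfl⟩ := h
    exact ((ih h4).image _).mono subset_union_right

/-- Families with cascade structure are isomorphic to initial segments of the colex order. The
permutation can be chosen to map any given ground set `B₀` to an initial interval, which is what the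
induction needs. -/
lemma IsCascade.exists_perm {N r : ℕ} {a : ℕ → ℕ} {F : Finset (Finset (Fin N))}
    (h : IsCascade r a F) (ha : ∀ i < r, r ≤ a i) {B₀ : Finset (Fin N)}
    (hF : F ⊆ powersetCard r B₀) :
    ∃ σ : Equiv.Perm (Fin N), B₀.image σ = ({i | i.val < #B₀} : Finset (Fin N)) ∧
      Colex.IsInitSeg (F.image (Finset.image σ)) r := by
  induction r generalizing a F B₀ with
  | zero =>
    obtain ⟨σ, -, hσ⟩ := exists_perm_extend (σ := Equiv.refl (Fin N)) (A := ∅) (B := B₀)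
      (by simp) (empty_subset _)
    refine ⟨σ, hσ, ?_⟩
    rw [show F = {∅} from h, image_singleton, image_empty]
    refine ⟨by simp [Set.Sized], fun s t _ ht => ?_⟩
    rw [mem_singleton, ← card_eq_zero]
    exact ht.2
  | succ r ih =>
    obtain ⟨B, x, F', hB, hx, hF', hc, rfl⟩ := h
    obtain ⟨σ, hσ, hI⟩ := ih hc (fun i hi => by have := ha (i + 1) (by omega); omega) hF'
    obtain ⟨τ₁, h1, h2, h3⟩ := exists_perm_insert hσ hx
    have hsub : insert x B ⊆ B₀ := by
      rw [insert_subset_iff]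
      constructor
      · obtain ⟨t, ht⟩ := hc.nonempty
        exact (mem_powersetCard.1 (hF (mem_union_right _ (mem_image_of_mem _ ht)))).1
          (mem_insert_self _ _)
      · intro y hy
        obtain ⟨u, hu1, hu2, hu3⟩ := exists_subsuperset_card_eq (singleton_subset_iff.2 hy)
          (n := r + 1) (by simp) (by rw [hB]; exact ha 0 (by omega))
        exact (mem_powersetCard.1 (hF (mem_union_left _ (mem_powersetCard.2 ⟨hu2, hu3⟩)))).1
          (hu1 (mem_singleton_self _))
    obtain ⟨τ, h4, h5⟩ := exists_perm_extend h3 hsub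
    have hτ : ∀ y ∈ B, τ y = σ y := fun y hy => (h4 y (mem_insert_of_mem hy)).trans (h1 y hy)
    have hτx : (τ x).val = #B := by rw [h4 x (mem_insert_self _ _), h2]
    have hBτ : B.image τ = Iio (τ x) := by
      rw [image_congr (g := σ) fun y hy => hτ y hy, hσ]
      ext i
      simp [Fin.lt_def, hτx]
    have hF'τ : F'.image (Finset.image τ) = F'.image (Finset.image σ) :=
      image_congr fun t ht =>
        image_congr fun y hy => hτ y ((mem_powersetCard.1 (hF' ht)).1 hy)
    refine ⟨τ, h5, ?_⟩
    have key : (powersetCard (r + 1) B ∪ F'.image (insert x)).image (Finset.image τ) =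
        powersetCard (r + 1) (Iio (τ x)) ∪ (F'.image (Finset.image τ)).image (insert (τ x)) := by
      rw [image_union, image_image_powersetCard, hBτ, image_image, image_image]
      congr 2
      funext t
      simp [image_insert]
    rw [key]
    refine isInitSeg_cone (hF'τ ▸ hI) ?_
    rw [← hBτ, ← image_image_powersetCard]
    exact image_subset_image hF'

lemma IsCascade.card_eq {α : Type*} [DecidableEq α] {r : ℕ} {a : ℕ → ℕ}
    {F : Finset (Finset α)} (h : IsCascade r a F) : #F = cascadeSum r a + 1 := by
  induction r generalizing a F with
  | zero => rw [show F = {∅} from h, card_singleton, cascadeSum]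
  | succ r ih =>
    obtain ⟨B, x, F', hB, hx, hF', hc, rfl⟩ := h
    rw [card_union_image_insert, card_powersetCard, hB, ih hc, cascadeSum, add_assoc]
    · exact fun s hs h => hx ((mem_powersetCard.1 hs).1 h)
    · exact fun s hs h => hx ((mem_powersetCard.1 (hF' hs)).1 h)

lemma binomSum_eq_cascadeSum (r t : ℕ) (hrt : r ≤ t) (a : ℕ → ℕ) :
    binomSum (r : ℤ) (fun i : Fin (t + 1) => a i) = cascadeSum r a + 1 := by
  induction r generalizing t a with
  | zero => exact binomSum_zero _
  | succ r ih =>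
    obtain ⟨t, rfl⟩ : ∃ t', t = t' + 1 := ⟨t - 1, by omega⟩
    rw [binomSum_succ, cascadeSum]
    exact (congrArg ((a 0).choose (r + 1) + ·) (ih t (by omega) fun i => a (i + 1))).trans
      (add_assoc _ _ _).symm

lemma cascadeSum_eq_sum (k : ℕ) (a : ℕ → ℕ) :
    cascadeSum k a = ∑ i ∈ range k, (a i).choose (k - i) := by
  induction k generalizing a with
  | zero => rfl
  | succ k ih =>
    rw [cascadeSum, sum_range_succ', ih, add_comm, Nat.sub_zero]
    congr 1
    exact sum_congr rfl fun i _ => by rw [Nat.add_sub_add_right]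

/-! ### Almost all numbers have a generic cascade -/

/-- The entries `a 0, …, a (k - 1)` are at least `w` and consecutive ones differ by at least `w`.
The entry `a k` only serves to express the bound on `a (k - 1)`. -/
def IsGapped (w k : ℕ) (a : ℕ → ℕ) : Prop := ∀ i < k, a (i + 1) + w ≤ a i

lemma IsGapped.tail {w k : ℕ} {a : ℕ → ℕ} (h : IsGapped w (k + 1) a) :
    IsGapped w k fun i => a (i + 1) := fun i hi => h (i + 1) (by omega)

lemma IsGapped.isSpread {D n w k : ℕ} {a : ℕ → ℕ} (h : IsGapped w k a) (hw : n + D ≤ D * w) :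
    IsSpread D n k a := by
  induction k generalizing a with
  | zero => trivial
  | succ k ih =>
    have hle : ∀ i < k + 1, D * a (i + 1) + D * w ≤ D * a i := fun i hi => by
      rw [← mul_add]
      exact Nat.mul_le_mul_left _ (h i hi)
    match k with
    | 0 => have := hle 0 (by omega); change n ≤ D * a 0; omega
    | 1 =>
      refine ⟨by have := h 0 (by omega); simp at this; omega, ?_⟩
      have := hle 1 (by omega)
      omega
    | k + 2 =>
      refine ⟨?_, ih h.tail⟩
      have := hle 0 (by omega)
      simp only [zero_add] at this
      omega

lemma IsGapped.isBinomDecomp {w t : ℕ} (hw : 0 < w) {a : ℕ → ℕ} (h : IsGapped w (t + 1) a) :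
    IsBinomDecomp (t + 1) (cascadeSum (t + 1) a) t fun i => a i where
  strictAnti := Fin.strictAnti_iff_succ_lt.2 fun i => by
    have := h i (by omega)
    simp only [Fin.val_succ, Fin.val_castSucc]
    omega
  lt := by omega
  le_last := by
    have := h t (by omega)
    simp only [Fin.val_last]
    omega
  sum_eq := by rw [cascadeSum_eq_sum, Finset.sum_range]

open Classical in
/-- All but `O(w * n ^ k)` numbers below `C(N, k + 1)` have a cascade with gaps at least `w`. -/
lemma card_not_gapped_le (w n k N : ℕ) (hN : N ≤ n) :
    #{m ∈ range (N.choose (k + 1)) |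
      ¬ ∃ a, IsGapped w (k + 1) a ∧ a 0 ≤ N ∧ cascadeSum (k + 1) a = m} ≤ (k + 1) * w * n ^ k := by
  -- the numbers below `C(b, k)` which do not extend the top entry `b` to a cascade with large gaps
  let bad (k b : ℕ) : Finset ℕ := {m ∈ range (b.choose k) |
    b < w ∨ ¬ ∃ a, IsGapped w k a ∧ a 0 ≤ b - w ∧ cascadeSum k a = m}
  have hstep (k N : ℕ) : #{m ∈ range (N.choose (k + 1)) |
      ¬ ∃ a, IsGapped w (k + 1) a ∧ a 0 ≤ N ∧ cascadeSum (k + 1) a = m} ≤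
      ∑ b ∈ range N, #(bad k b) := by
    have hsub : ({m ∈ range (N.choose (k + 1)) |
        ¬ ∃ a, IsGapped w (k + 1) a ∧ a 0 ≤ N ∧ cascadeSum (k + 1) a = m} : Finset ℕ) ⊆
        (range N).biUnion fun b => (bad k b).image fun m' => b.choose (k + 1) + m' := by
      intro m hm
      rw [mem_filter, mem_range] at hm
      obtain ⟨hmN, hm⟩ := hm
      obtain ⟨b, m', hb, hm', hmb⟩ : ∃ b m', b < N ∧ m' < b.choose k ∧
          m = b.choose (k + 1) + m' := by
        rcases Nat.eq_zero_or_pos m with rfl | hm0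
        · refine ⟨k, 0, ?_, by simp, by simp⟩
          by_contra hcon
          rw [Nat.choose_eq_zero_of_lt (by omega)] at hmN
          omega
        · obtain ⟨b, m', hb, hm', rfl⟩ := exists_choose_add (j := k) hm0
          refine ⟨b, m', ?_, hm', rfl⟩
          have := le_of_choose_lt (a := b) (v := N) (r := k + 1) (by omega)
          omega
      refine mem_biUnion.2 ⟨b, mem_range.2 hb, mem_image.2 ⟨m', ?_, hmb.symm⟩⟩
      refine mem_filter.2 ⟨mem_range.2 hm', ?_⟩
      by_contra! hcon
      obtain ⟨hbw, a, ha1, ha2, ha3⟩ := hcon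
      refine hm ⟨fun i => if i = 0 then b else a (i - 1), fun i hi => ?_, by simp; omega, ?_⟩
      · rcases Nat.eq_zero_or_pos i with rfl | hi0
        · simp
          omega
        · simp only [Nat.add_eq_zero_iff, one_ne_zero, and_false, if_false, Nat.add_sub_cancel]
          rw [if_neg (by omega)]
          have := ha1 (i - 1) (by omega)
          rwa [Nat.sub_add_cancel hi0] at this
      · rw [hmb, ← ha3]
        simp [cascadeSum]
    refine (card_le_card hsub).trans (card_biUnion_le.trans (sum_le_sum fun b _ => card_image_le))
  induction k generalizing N with
  | zero =>
    refine (hstep 0 N).trans ?_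
    calc ∑ b ∈ range N, #(bad 0 b) ≤ ∑ b ∈ range N, if b < w then 1 else 0 := by
          refine sum_le_sum fun b _ => ?_
          split_ifs with hbw
          · exact (card_filter_le _ _).trans (by simp)
          · rw [Nat.le_zero, card_eq_zero, filter_eq_empty_iff]
            intro m hm
            rw [mem_range, Nat.choose_zero_right] at hm
            simp only [hbw, false_or, not_not]
            exact ⟨fun _ => 0, fun i hi => by omega, Nat.zero_le _, by rw [cascadeSum]; omega⟩
      _ ≤ #(range w) := by
          rw [← card_filter]
          exact card_le_card fun b hb => mem_range.2 (mem_filter.1 hb).2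
      _ = _ := by simp
  | succ k ih =>
    refine (hstep (k + 1) N).trans ?_
    have hb : ∀ b ∈ range N, #(bad (k + 1) b) ≤ (k + 2) * w * n ^ k := by
      intro b hb
      rw [mem_range] at hb
      have h1 : bad (k + 1) b ⊆ ({m ∈ range ((b - w).choose (k + 1)) |
          ¬ ∃ a, IsGapped w (k + 1) a ∧ a 0 ≤ b - w ∧ cascadeSum (k + 1) a = m} : Finset ℕ) ∪
          Ico ((b - w).choose (k + 1)) (b.choose (k + 1)) := by
        intro m hm
        rw [mem_filter, mem_range] at hm
        rw [mem_union, mem_filter, mem_range, mem_Ico]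
        rcases lt_or_ge m ((b - w).choose (k + 1)) with h | h
        · refine Or.inl ⟨h, hm.2.resolve_left fun hbw => ?_⟩
          rw [show b - w = 0 by omega, Nat.choose_zero_succ] at h
          omega
        · exact Or.inr ⟨h, hm.1⟩
      have h2 := (card_le_card h1).trans (card_union_le _ _)
      have h3 := ih (b - w) (by omega)
      have h4 : b.choose (k + 1) ≤ (b - w).choose (k + 1) + w * n ^ k := by
        have h5 := choose_le_add_mul (b - w) (b - (b - w)) k
        rw [show b - w + (b - (b - w)) = b by omega] at h5
        refine h5.trans (Nat.add_le_add_left (Nat.mul_le_mul (by omega) ?_) _)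
        exact (Nat.choose_le_pow _ _).trans (Nat.pow_le_pow_left (by omega) _)
      rw [Nat.card_Ico] at h2
      have h6 : (k + 2) * w * n ^ k = (k + 1) * w * n ^ k + w * n ^ k := by ring
      omega
    refine (sum_le_sum hb).trans ?_
    rw [sum_const, card_range, smul_eq_mul]
    calc N * ((k + 2) * w * n ^ k) ≤ n * ((k + 2) * w * n ^ k) := Nat.mul_le_mul_right _ hN
      _ = _ := by ring

/-- Numbers with a cascade of large gaps belong to `goodCards`. -/
lemma exists_mem_goodCards {D : ℕ} (hD : 0 < D) (t : ℕ) :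
    ∃ n₀, ∀ n ≥ n₀, ∀ w, n + D ≤ D * w → ∀ a, IsGapped w (t + 1) a →
      cascadeSum (t + 1) a < n.choose (t + 1) → cascadeSum (t + 1) a ∈ goodCards n (t + 1) := by
  obtain ⟨n₁, hn₁⟩ := exists_isCascade (t - 3) hD
  refine ⟨n₁ + D * (t + 1) + 1, fun n hn w hw a ha hlt => ⟨⟨?_, hlt.le⟩, fun S hS hSm => ?_⟩⟩
  · rw [cascadeSum]
    have := Nat.choose_pos ((ha.isSpread hw).lt_top (c := t + 1) (by omega)).le
    omega
  have hw0 : 0 < w := Nat.pos_of_ne_zero fun h => by subst h; omega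
  refine ⟨t, fun i => a i, ha.isBinomDecomp hw0, ?_⟩
  rcases lt_or_ge t 3 with ht | ht
  · -- here `k < 4`
    have h1 : shadow^[4] S = ∅ := by
      rw [eq_empty_iff_forall_notMem]
      intro u hu
      obtain ⟨s, hs, -, hsu⟩ := mem_shadow_iterate_iff_exists_mem_card_add.1 hu
      rw [hS.1 hs] at hsu
      omega
    rw [h1, binomSum_of_neg (by push_cast; omega)]
    exact ⟨∅, Equiv.refl _, Colex.isInitSeg_empty, rfl, rfl⟩
  · obtain ⟨l, rfl⟩ : ∃ l, t = l + 3 := ⟨t - 3, by omega⟩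
    rw [Nat.add_sub_cancel] at hn₁
    have hspread := ha.isSpread hw
    obtain ⟨hsized, t', a', hdec, hsh⟩ := hS
    have hcas := hn₁ n (by omega) a S ⟨hsized, hspread, hSm, by rw [hsh, hdec.kk_eq_binomSum]⟩
    have hsub : shadow^[4] S ⊆ powersetCard l univ :=
      shadow_iterate_subset_powersetCard fun s hs => mem_powersetCard.2 ⟨subset_univ _, hsized hs⟩
    obtain ⟨σ, -, hσ⟩ := hcas.exists_perm (fun i hi => by
      have h1 : ∀ j, j ≤ l + 3 → w ≤ a j := fun j hj => by have := ha j (by omega); omega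
      have h2 : l ≤ w := by
        refine le_of_mul_le_mul_left (a := D) ?_ hD
        have := Nat.mul_le_mul_left D (show l ≤ l + 3 + 1 by omega)
        omega
      exact h2.trans (h1 i (by omega))) hsub
    refine ⟨_, σ, hσ, ?_, rfl⟩
    rw [card_image_of_injective _ (Finset.image_injective σ.injective), hcas.card_eq,
      show ((l + 3 + 1 : ℕ) : ℤ) - 4 = (l : ℕ) by push_cast; ring,
      binomSum_eq_cascadeSum l (l + 3) (by omega)]

end ColexShadow

open ColexShadow in
theorem theorem7 (k : ℕ) (hk : 0 < k) :
    Filter.Tendsto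
      (fun n : ℕ => ((ColexShadow.goodCards n k).ncard : ℝ) / (n.choose k : ℝ))
      Filter.atTop (nhds 1) := by
  classical
  obtain ⟨t, rfl⟩ : ∃ t, k = t + 1 := ⟨k - 1, by omega⟩
  have hfin (n : ℕ) : goodCards n (t + 1) ⊆ (Icc 1 (n.choose (t + 1)) : Finset ℕ) := fun m hm => by
    rw [coe_Icc]
    exact hm.1
  have hupper (n : ℕ) : (goodCards n (t + 1)).ncard ≤ n.choose (t + 1) := by
    refine (Set.ncard_le_ncard (hfin n) (finite_toSet _)).trans ?_
    rw [Set.ncard_coe_finset, Nat.card_Icc, Nat.add_sub_cancel]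
  obtain ⟨K, hK, hpow⟩ := exists_pow_le_mul_choose one_pos (t + 1)
  rw [tendsto_order]
  constructor
  · intro c hc
    obtain ⟨D, hD⟩ := exists_nat_gt (2 * (t + 1) * K / (1 - c))
    have hc' : 0 < 1 - c := by linarith
    have hD0 : 0 < D := by
      have : (0 : ℝ) ≤ 2 * (t + 1) * K / (1 - c) := by positivity
      exact_mod_cast this.trans_lt hD
    obtain ⟨n₀, hn₀⟩ := exists_mem_goodCards hD0 t
    filter_upwards [Filter.eventually_ge_atTop (n₀ + 2 * D + 2 * (t + 1) * 1)] with n hn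
    have hw : n + D ≤ D * (n / D + 2) := by
      have := Nat.lt_div_mul_add (a := n) hD0
      rw [mul_add, mul_comm D (n / D)]
      omega
    have hw2 : D * (n / D + 2) ≤ 2 * n := by
      have := Nat.div_mul_le_self n D
      rw [mul_add, mul_comm D (n / D)]
      omega
    have hbad := card_not_gapped_le (n / D + 2) n t n le_rfl
    set P : ℕ → Prop := fun m =>
      ∃ a, IsGapped (n / D + 2) (t + 1) a ∧ a 0 ≤ n ∧ cascadeSum (t + 1) a = m with hP
    have hsub : (({m ∈ range (n.choose (t + 1)) | P m} : Finset ℕ) : Set ℕ) ⊆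
        goodCards n (t + 1) := by
      intro m hm
      rw [mem_coe, mem_filter, mem_range] at hm
      obtain ⟨hm, a, ha, -, rfl⟩ := hm
      exact hn₀ n (by omega) _ hw a ha hm
    have hgood := Set.ncard_le_ncard hsub ((finite_toSet _).subset (hfin n))
    rw [Set.ncard_coe_finset] at hgood
    have hsum : #{m ∈ range (n.choose (t + 1)) | P m} +
        #{m ∈ range (n.choose (t + 1)) | ¬ P m} = n.choose (t + 1) := by
      conv_rhs => rw [← card_range (n.choose (t + 1)),
        ← card_filter_add_card_filter_not (s := range (n.choose (t + 1))) P]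
    have hKn := hpow n n (by omega) (by omega)
    have hC : 0 < n.choose (t + 1) := Nat.choose_pos (by omega)
    have hloss : D * #{m ∈ range (n.choose (t + 1)) | ¬ P m} ≤
        2 * (t + 1) * K * n.choose (t + 1) := by
      calc D * #{m ∈ range (n.choose (t + 1)) | ¬ P m}
          ≤ D * ((t + 1) * (n / D + 2) * n ^ t) := Nat.mul_le_mul_left _ hbad
        _ = (t + 1) * n ^ t * (D * (n / D + 2)) := by ring
        _ ≤ (t + 1) * n ^ t * (2 * n) := Nat.mul_le_mul_left _ hw2
        _ = 2 * (t + 1) * n ^ (t + 1) := by ring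
        _ ≤ 2 * (t + 1) * (K * n.choose (t + 1)) := Nat.mul_le_mul_left _ hKn
        _ = _ := by ring
    have h1 : (n.choose (t + 1) : ℝ) ≤ (goodCards n (t + 1)).ncard +
        #{m ∈ range (n.choose (t + 1)) | ¬ P m} := by
      exact_mod_cast (by omega)
    have h2 : (D : ℝ) * #{m ∈ range (n.choose (t + 1)) | ¬ P m} ≤
        2 * (t + 1) * K * n.choose (t + 1) := by exact_mod_cast hloss
    have h3 : (0 : ℝ) < n.choose (t + 1) := by exact_mod_cast hC
    have h4 : (0 : ℝ) < D := by exact_mod_cast hD0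
    rw [div_lt_iff₀ hc'] at hD
    rw [lt_div_iff₀ h3]
    have h5 : (#{m ∈ range (n.choose (t + 1)) | ¬ P m} : ℝ) < (1 - c) * n.choose (t + 1) := by
      refine lt_of_mul_lt_mul_left (a := (D : ℝ)) ?_ h4.le
      calc _ ≤ _ := h2
        _ < D * (1 - c) * n.choose (t + 1) := mul_lt_mul_of_pos_right hD h3
        _ = _ := by ring
    linarith
  · intro c hc
    refine Filter.Eventually.of_forall fun n => lt_of_le_of_lt ?_ hc
    exact div_le_one_of_le₀ (by exact_mod_cast hupper n) (by positivity)
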